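/- **Setting.** Let $S$ and $A$ be finite sets of states and actions, $P(\cdot\mid s,a)$ a fixed transition law, and $\mu_0$ the law of the initial state. A policy $\pi$ assigns to each state a probability distribution on $A$; write $P(\pi)_{s,s'}=\sum_a\pi(a\mid s)P(s'\mid s,a)$. Let $\tau\ge 1$ be a mixing time: $\|dP(\pi)-d'P(\pi)\|_1\le e^{-1/\tau}\|d-d'\|_1$ for every policy $\pi$ and all distributions $d,d'$ on $S$. Every policy then has a unique stationary distribution $d_\pi$, which also denotes the distribution $d_\pi(s)\pi(a\mid s)$ on $S\times A$. For $l:S\times A\to\mathbb R$ put $\eta_l(\pi)=\langle l,d_\pi\rangle$ and $$Q_{\pi,l}(s,a)=\sum_{t\ge1}\mathbb E\big[l(s_t,a_t)-\eta_l(\pi)\,\big|\,s_1=s,a_1=a,\pi\big].$$ **Adversary.** Let $l_1,\dots,l_L\in[0,1]^{S\times A}$ and let $\Delta_L$ be the set of their convex combinations. In round $t$ the adversary plays a loss function in $\Delta_L$ that is a function of the agent's earlier policies $\pi_1,\dots,\pi_{t-1}$. Write $l_t^{\pi_t}$ for its losses when the agent uses $\pi_1,\pi_2,\dots$, and $l_t^{\pi}$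 for its losses when the agent uses the fixed policy $\pi$ in every round. The adversary is no-regret over the horizon $T$: for every sequence of policies $\pi_1,\pi_2,\dots$, $$\max_{l\in\Delta_L}\sum_{t=1}^T\langle l,d_{\pi_t}\rangle-\sum_{t=1}^T\langle l_t^{\pi_t},d_{\pi_t}\rangle\le\sqrt{\tfrac{T\log L}{2}} .$$ **MDP-Online Oracle Expert (MDP-OOE).** The agent keeps an effective set $A_t^s\subseteq A$ for each state $s$. The initial sets $A_0^s$ are arbitrary sets of the same size for all $s$. A time window is a maximal period in which all the effective sets stay fixed. In round $t$: 1. Compute a deterministic best response $f_t$, a minimiser of $\langle\bar l,d_f\rangle$ over deterministic policies $f$, where $\bar l$ is the sum of the losses so far in the window to which round $t-1$ belongs ($\bar l=0$ for $t=1$). 2. If $f_t(s)\in A_{t-1}^s$ for all $s$, set $A_t^s=A_{t-1}^s$ for all $s$. Otherwise start a new window, and for every $s$ set $A_t^s=A_{t-1}^s\cup\{f_t(s)\}$ if $f_t(s)\notin A_{t-1}^s$, and $A_t^s=A_{t-1}^s\cup\{a\}$ with an arbitrarily (e.g. randomly) drawn $a\in A\setminus A_{t-1}^s$ if $f_t(s)\in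 A_{t-1}^s$. 3. Play the policy $\pi_t$ that in each state $s$ is given by the exponentially weighted average forecaster on $A_t^s$, restarted at the beginning of the window: in the $n$-th round of a window with $|A_t^s|=i$, $$\pi_t(a\mid s)\propto\exp\Big(-\sqrt{\tfrac{8\log i}{n}}\ \sum_{j}\tfrac{1}{3\tau}Q_{\pi_j,l_j^{\pi_j}}(s,a)\Big),\qquad a\in A_t^s,$$ where $j$ runs over the earlier rounds of the window, and $\pi_t(a\mid s)=0$ for $a\notin A_t^s$. Let $k$ be the number of time windows $T_1,\dots,T_k$ in the first $T$ rounds, a window being labelled by the size of the effective sets, $T_i=\{t\le T:|A_t^s|=i\}$; that is, $k$ is the largest $i$ with $T_i\neq\emptyset$ ($k=0$ if $T=0$). **Policy regret.** For a policy $\pi$, $$R_T(\pi)=\mathbb E\Big[\sum_{t=1}^T l_t^{\pi_t}(X_t,A_t)\Big]-\mathbb E\Big[\sum_{t=1}^T l_t^{\pi}(X_t^{\pi},A_t^{\pi})\Big],$$ where $(X_t,A_t)$ is the trajectory when the agent uses $\pi_1,\pi_2,\dots$, and $(X_t^{\pi},A_t^{\pi})$ the trajectory when it always uses $\pi$. **Theorem.**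 There is a universal constant $C>0$ such that in this setting, for every horizon $T$, every run of MDP-OOE (every outcome of the draws in step 2) and every policy $\pi$, $$R_T(\pi)\le C\Big(\tau^2\sqrt{Tk\log k}+\sqrt{T\log L}+\tau\Big).$$ Moreover, if $k\ge2$, or if $L\ge2$ and $T\ge\tau^2$, then $$R_T(\pi)\le C\Big(\tau^2\sqrt{Tk\log k}+\sqrt{T\log L}\Big).$$ -/

import Mathlib

open scoped BigOperators

universe u v

noncomputable section

/-- Stationary (randomised) policies: `π s` is a probability distribution on actions. -/
abbrev Policy (S A : Type*) [Fintype A] := S → stdSimplex ℝ A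

/-- The deterministic policy that plays `f s` in state `s`. -/
def detPolicy {S A : Type*} [Fintype A] (f : S → A) : Policy S A := by
  classical
  exact fun s => ⟨Pi.single (f s) 1, single_mem_stdSimplex ℝ (f s)⟩

/-- The fixed data of a finite online Markov decision process: the initial distribution `μ₀`
and the transition law `P(· | s, a)`. The loss functions are chosen online. -/
structure OnlineMDP (S A : Type*) [Fintype S] [Fintype A] where
  init : stdSimplex ℝ S
  trans : S → A → stdSimplex ℝ S

namespace OnlineMDP

variable {S A : Type*} [Fintype S] [Fintype A] (M : OnlineMDP S A)

/-- The state transition matrix `P(π)` induced by a policy. -/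
def transMatrix (π : Policy S A) (s s' : S) : ℝ :=
  ∑ a, (π s).1 a * (M.trans s a).1 s'

/-- The row vector `d P(π)`. -/
def push (π : Policy S A) (d : S → ℝ) (s' : S) : ℝ :=
  ∑ s, d s * M.transMatrix π s s'

/-- The mixing time condition: every policy contracts the `l₁` distance of state distributions
by the factor `e^{-1/τ}`. -/
def HasMixingTime (τ : ℝ) : Prop :=
  ∀ (π : Policy S A), ∀ d ∈ stdSimplex ℝ S, ∀ d' ∈ stdSimplex ℝ S,
    ∑ s, |M.push π d s - M.push π d' s| ≤ Real.exp (-1 / τ) * ∑ s, |d s - d' s|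

/-- `d` is a stationary distribution on states for the policy `π`. -/
def IsStationary (π : Policy S A) (d : S → ℝ) : Prop :=
  d ∈ stdSimplex ℝ S ∧ M.push π d = d

open Classical in
/-- The stationary state distribution of `π`
(it exists and is unique under the mixing time condition). -/
def statDist (π : Policy S A) : S → ℝ :=
  if h : ∃ d, M.IsStationary π d then h.choose else 0

/-- `η_l(π) = ⟨l, d_π⟩`, where `d_π(s, a) = d_π(s) π(a | s)` is the stationary distribution on
state-action pairs. -/
def avgLoss (l : S → A → ℝ) (π : Policy S A) : ℝ :=
  ∑ s, ∑ a, M.statDist π s * (π s).1 a * l s a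

/-- One step of the state-action chain under `π`: from the law of `(s_t, a_t)` to the law of
`(s_{t+1}, a_{t+1})`. -/
def stepSA (π : Policy S A) (w : S × A → ℝ) (z : S × A) : ℝ :=
  (∑ y, w y * (M.trans y.1 y.2).1 z.1) * (π z.1).1 z.2

open Classical in
/-- The law of the `(n + 1)`-st state-action pair when the first one is `(s, a)` and actions are
afterwards drawn from `π`. -/
def lawFrom (π : Policy S A) (s : S) (a : A) (n : ℕ) : S × A → ℝ :=
  (M.stepSA π)^[n] (Pi.single (s, a) 1)

/-- The accumulated loss `Q_{π,l}(s, a)`, the sum over time of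
`E[l(s_t, a_t) - η_l(π) | s_1 = s, a_1 = a, π]`. -/
def Q (π : Policy S A) (l : S → A → ℝ) (s : S) (a : A) : ℝ :=
  ∑' n : ℕ, ((∑ z, M.lawFrom π s a n z * l z.1 z.2) - M.avgLoss l π)

/-- The probability of the trajectory `ω = ((x_1, a_1), …, (x_n, a_n))` when policy `π t` is used
in round `t + 1`. -/
def trajProb (π : ℕ → Policy S A) : (n : ℕ) → (Fin n → S × A) → ℝ
  | 0, _ => 1
  | 1, ω => M.init.1 (ω 0).1 * (π 0 (ω 0).1).1 (ω 0).2
  | n + 2, ω =>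
      trajProb π (n + 1) (Fin.init ω)
        * (M.trans (ω (Fin.last n).castSucc).1 (ω (Fin.last n).castSucc).2).1
            (ω (Fin.last (n + 1))).1
        * (π (n + 1) (ω (Fin.last (n + 1))).1).1 (ω (Fin.last (n + 1))).2

/-- `E_{X,A}[∑_{t ≤ T} l_t(X_t, A_t)]` when the policies `π` are used against the losses `l`. -/
def expectedLoss (π : ℕ → Policy S A) (l : ℕ → S → A → ℝ) (T : ℕ) : ℝ :=
  ∑ ω : Fin T → S × A, M.trajProb π T ω * ∑ t : Fin T, l t (ω t).1 (ω t).2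

/-- The deterministic policy `f` is a best response to the loss `l`: it has the least stationary
loss among all deterministic policies (the agent's pure strategies). -/
def IsBestResponse (l : S → A → ℝ) (f : S → A) : Prop :=
  ∀ g : S → A, M.avgLoss l (detPolicy f) ≤ M.avgLoss l (detPolicy g)

end OnlineMDP

/-- `Δ_L`: the mixtures of the `L` loss vectors of the adversary. -/
def lossSimplex {S A : Type*} {L : ℕ} (ℓ : Fin L → S → A → ℝ) : Set (S → A → ℝ) :=
  {l | ∃ x ∈ stdSimplex ℝ (Fin L), l = ∑ i, x i • ℓ i}

/-- A non-oblivious adversary: in each round it chooses an element of `Δ_L` as a function of the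
policies that the agent has used in the earlier rounds. -/
structure Adversary {S A : Type*} [Fintype A] {L : ℕ} (ℓ : Fin L → S → A → ℝ) where
  play : (t : ℕ) → (Fin t → Policy S A) → S → A → ℝ
  play_mem : ∀ t h, play t h ∈ lossSimplex ℓ

namespace Adversary

variable {S A : Type*} [Fintype S] [Fintype A] {L : ℕ} {ℓ : Fin L → S → A → ℝ}

/-- The losses (index `t` is round `t + 1`) that the adversary plays when the agent uses the
policies `π 0, π 1, …`. -/
def losses (adv : Adversary ℓ) (π : ℕ → Policy S A) (t : ℕ) : S → A → ℝ :=
  adv.play t fun i => π i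

/-- The adversary's external regret over `T` rounds, with respect to the stationary distributions
of the agent's policies, is at most `√(T log L / 2)` whatever policies the agent uses. -/
def NoRegret (adv : Adversary ℓ) (M : OnlineMDP S A) (T : ℕ) : Prop :=
  ∀ σ : ℕ → Policy S A, ∀ l ∈ lossSimplex ℓ,
    ∑ t ∈ Finset.range T, M.avgLoss l (σ t)
      - ∑ t ∈ Finset.range T, M.avgLoss (adv.losses σ t) (σ t)
      ≤ √(T * Real.log L / 2)

/-- The policy regret of the agent using `π 0, π 1, …` relative to the fixed policy `ρ`: the
second term is measured against the losses that the adversary would play against `ρ`. -/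
def policyRegret (adv : Adversary ℓ) (M : OnlineMDP S A) (π : ℕ → Policy S A) (ρ : Policy S A)
    (T : ℕ) : ℝ :=
  M.expectedLoss π (adv.losses π) T
    - M.expectedLoss (fun _ => ρ) (adv.losses fun _ => ρ) T

end Adversary

open Classical in
/-- Rounds `j < t` in which the family of effective strategy sets was `F`. Here `E 0` is the
family of initial sets and `E (j + 1)` is the family in force in round `j` (counted from `0`). -/
def roundsWith {S A : Type*} (E : ℕ → S → Finset A) (t : ℕ) (F : S → Finset A) : Finset ℕ :=
  (Finset.range t).filter fun j => E (j + 1) = F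

open Classical in
/-- The exponentially weighted average forecaster on the set of experts `F`, with learning rate
`μ` and cumulative losses `c`. -/
def expWeights {A : Type*} (F : Finset A) (μ : ℝ) (c : A → ℝ) (a : A) : ℝ :=
  if a ∈ F then Real.exp (-μ * c a) / ∑ b ∈ F, Real.exp (-μ * c b) else 0

open Classical in
/-- `E, f, π` describe a run of MDP-Online Oracle Expert against the losses `l`; rounds are
counted from `0`. In round `t`, `f t` is the best response that is computed, `E (t + 1)` are the
effective strategy sets after the update, and `π t` is the policy played. No condition is put on
how the arbitrary actions of an update are drawn, so every outcome of these draws is a run. -/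
structure IsOOERun {S A : Type*} [Fintype S] [Fintype A] (M : OnlineMDP S A) (τ : ℝ)
    (l : ℕ → S → A → ℝ) (E : ℕ → S → Finset A) (f : ℕ → S → A) (π : ℕ → Policy S A) : Prop where
  /-- The initial sets have the same size in all states. -/
  init_card : ∀ s s', (E 0 s).card = (E 0 s').card
  /-- `f t` is a best response to the total loss so far in the current time window. -/
  best_response : ∀ t, M.IsBestResponse (∑ j ∈ roundsWith E t (E t), l j) (f t)
  /-- If the best response uses effective strategies only, then the sets are kept. -/
  keep : ∀ t, (∀ s, f t s ∈ E t s) → E (t + 1) = E t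
  /-- Otherwise every set gets one new action: that of the best response if it is new, and an
  arbitrary new action if it is not. -/
  expand : ∀ t, (∃ s, f t s ∉ E t s) → ∀ s,
    (f t s ∉ E t s → E (t + 1) s = insert (f t s) (E t s)) ∧
    (f t s ∈ E t s → ∃ a, a ∉ E t s ∧ E (t + 1) s = insert a (E t s))
  /-- In each state the policy is that of the expert algorithm on the effective set, restarted at
  the beginning of the time window, with feedback `Q_{π_j, l_j}(s, ·)` scaled by `1 / (3τ)` and
  with learning rate `√(8 log i / n)` in the `n`-th round of a window with sets of size `i`. -/
  play : ∀ t s a, (π t s).1 a =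
    expWeights (E (t + 1) s)
      (√(8 * Real.log (E (t + 1) s).card / ((roundsWith E t (E (t + 1))).card + 1)))
      (fun b => ∑ j ∈ roundsWith E t (E (t + 1)), M.Q (π j) (l j) s b / (3 * τ)) a

/-- The number `k` of time windows `T_1, …, T_k` in the first `T` rounds. A window is labelled by
the size of the effective strategy sets, `T_i = {t | |A_t^s| = i}`, so `k` is the largest `i` for
which `T_i` is not empty. The sizes grow by exactly one from each window to the next, so with empty
initial sets this is literally the number of windows (with singletons, `T_1` counts even if the
sets grow in the first round). -/
def numWindows {S A : Type*} [Fintype S] (E : ℕ → S → Finset A) (T : ℕ) : ℕ :=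
  (Finset.range T).sup fun t => Finset.univ.sup fun s => (E (t + 1) s).card

end

noncomputable section

/-! Write X = √(Tk log k). The policy regret splits into three parts. (a) Replacing trajectory
losses by stationary losses. By contraction, the state law follows the stationary law of the current
policy at a total cost of O(τ) times (1 + total drift of the stationary laws). For the fixed
comparator the drift is zero. For the agent, the stationary law is O(τ)-Lipschitz in the policy.
Exponential weights move by O(√(log k / n)) in the n-th round of a window, and each change of window
costs at most 2, so the drift is O(τX) (`sum_statDist_drift_le`). (b) Stationary regret against the
losses actually played (`regret_le`). If the last round t of a window is not also its first, no set
was enlarged at t. Hence the best response to the window's earlier losses lies in the effective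
sets, and it does at least as well on them as any policy. It therefore suffices to compete with that
one policy, at the price of 1 for the last round. The performance difference identity turns this
into an average over states of expert regrets with feedback Q, each O(√(n log i)) by
`expWeights_regret_le`. Cauchy-Schwarz over the at most k windows gives O(τX). (c) Replacing the
losses played against the agent by those played against the comparator. The time average of the
former lies in Δ_L, so the no-regret property along the constant sequence pays for the exchange with
√(T log L / 2). When k = 1, X vanishes while the constants in (a) and (b) remain; this is the extra
τ, which is absorbed as soon as X ≥ 1 or τ ≤ 2√(T log L). -/

/-! ### Elementary inequalities. -/

theorem one_le_two_mul_mul_one_sub_exp {τ : ℝ} (hτ : 1 ≤ τ) :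
    1 ≤ 2 * τ * (1 - Real.exp (-1 / τ)) := by
  have h0 : 0 < τ := by linarith
  -- The chain is 1 - e^{-1/τ} ≥ 1/(τ+1) ≥ 1/(2τ); it turns every geometric factor 1/(1 - e^{-1/τ})
  -- below into 2τ.
  have h1 : 1 + 1 / τ ≤ Real.exp (1 / τ) := by linarith [Real.add_one_le_exp (1 / τ)]
  have h2 : Real.exp (-1 / τ) ≤ τ / (τ + 1) := by
    rw [show -1 / τ = -(1 / τ) by ring, Real.exp_neg,
      show τ / (τ + 1) = (1 + 1 / τ)⁻¹ by field_simp]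
    exact inv_anti₀ (by positivity) h1
  have h3 : 1 ≤ 2 * τ * (1 - τ / (τ + 1)) := by
    rw [show 2 * τ * (1 - τ / (τ + 1)) = 2 * τ / (τ + 1) by field_simp; ring,
      le_div_iff₀ (by linarith)]
    linarith
  nlinarith

theorem sum_abs_sub_le_two {S : Type*} [Fintype S] {d d' : S → ℝ} (hd : d ∈ stdSimplex ℝ S)
    (hd' : d' ∈ stdSimplex ℝ S) : ∑ s, |d s - d' s| ≤ 2 := by
  calc ∑ s, |d s - d' s| ≤ ∑ s, (d s + d' s) := by
        gcongr with s
        rw [abs_le]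
        constructor <;> linarith [hd.1 s, hd'.1 s]
    _ = 2 := by rw [Finset.sum_add_distrib, hd.2, hd'.2]; norm_num

theorem sum_mul_mem_Icc {A : Type*} [Fintype A] {p : A → ℝ} (hp : p ∈ stdSimplex ℝ A)
    {g : A → ℝ} {b c : ℝ} (hg : ∀ a, g a ∈ Set.Icc b c) : ∑ a, p a * g a ∈ Set.Icc b c := by
  constructor
  · calc b = ∑ a, p a * b := by rw [← Finset.sum_mul, hp.2, one_mul]
      _ ≤ _ := by
        gcongr with a
        · exact hp.1 a
        · exact (hg a).1
  · calc _ ≤ ∑ a, p a * c := by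
          gcongr with a
          · exact hp.1 a
          · exact (hg a).2
      _ = c := by rw [← Finset.sum_mul, hp.2, one_mul]

theorem abs_sum_mul_sub_le {S : Type*} [Fintype S] {h : S → ℝ} (hh : ∀ s, |h s| ≤ 1)
    (d d' : S → ℝ) : |∑ s, d s * h s - ∑ s, d' s * h s| ≤ ∑ s, |d s - d' s| := by
  rw [← Finset.sum_sub_distrib]
  refine (Finset.abs_sum_le_sum_abs _ _).trans (Finset.sum_le_sum fun s _ => ?_)
  rw [← sub_mul, abs_mul]
  exact mul_le_of_le_one_right (abs_nonneg _) (hh s)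

/-! ### Mixing and stationary distributions. -/

namespace OnlineMDP

variable {S A : Type*} [Fintype S] [Fintype A] (M : OnlineMDP S A)

include M in
theorem nonempty_states : Nonempty S := by
  by_contra hS
  have := not_nonempty_iff.1 hS
  simpa using M.init.2.2

theorem transMatrix_mem (π : Policy S A) (s : S) : M.transMatrix π s ∈ stdSimplex ℝ S := by
  constructor
  · exact fun s' => Finset.sum_nonneg fun a _ => mul_nonneg ((π s).2.1 a) ((M.trans s a).2.1 s')
  · simp only [transMatrix]
    rw [Finset.sum_comm]
    simp_rw [← Finset.mul_sum, (M.trans s _).2.2, mul_one]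
    exact (π s).2.2

theorem push_mem (π : Policy S A) {d : S → ℝ} (hd : d ∈ stdSimplex ℝ S) :
    M.push π d ∈ stdSimplex ℝ S := by
  constructor
  · exact fun s' => Finset.sum_nonneg fun s _ =>
      mul_nonneg (hd.1 s) ((M.transMatrix_mem π s).1 s')
  · simp only [push]
    rw [Finset.sum_comm]
    simp_rw [← Finset.mul_sum, (M.transMatrix_mem π _).2, mul_one]
    exact hd.2

theorem push_iterate_mem (π : Policy S A) {d : S → ℝ} (hd : d ∈ stdSimplex ℝ S) (n : ℕ) :
    (M.push π)^[n] d ∈ stdSimplex ℝ S := by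
  induction n with
  | zero => exact hd
  | succ n ih => rw [Function.iterate_succ_apply']; exact M.push_mem π ih

variable {M} {τ : ℝ}

theorem HasMixingTime.sum_abs_iterate_le (hM : M.HasMixingTime τ) (π : Policy S A) {d d' : S → ℝ}
    (hd : d ∈ stdSimplex ℝ S) (hd' : d' ∈ stdSimplex ℝ S) (n : ℕ) :
    ∑ s, |(M.push π)^[n] d s - (M.push π)^[n] d' s| ≤ 2 * Real.exp (-1 / τ) ^ n := by
  induction n with
  | zero => simpa using sum_abs_sub_le_two hd hd'
  | succ n ih =>
    rw [Function.iterate_succ_apply', Function.iterate_succ_apply']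
    refine (hM π _ (M.push_iterate_mem π hd n) _ (M.push_iterate_mem π hd' n)).trans ?_
    rw [pow_succ]
    nlinarith [Real.exp_pos (-1 / τ)]

theorem exp_rate_lt_one (hτ : 1 ≤ τ) : Real.exp (-1 / τ) < 1 := by
  rw [Real.exp_lt_one_iff]
  exact div_neg_of_neg_of_pos (by norm_num) (by linarith)

theorem HasMixingTime.exists_isStationary (hM : M.HasMixingTime τ) (hτ : 1 ≤ τ)
    (π : Policy S A) : ∃ d, M.IsStationary π d := by
  let x : ℕ → S → ℝ := fun n => (M.push π)^[n] M.init.1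
  have hx : ∀ n, x n ∈ stdSimplex ℝ S := M.push_iterate_mem π M.init.2
  -- Consecutive terms are the n-th iterates of two starting laws, the initial law and its push,
  -- hence geometrically close.
  have hc : CauchySeq x := by
    refine cauchySeq_of_le_geometric _ 2 (exp_rate_lt_one hτ) fun n => ?_
    rw [dist_pi_le_iff (by positivity)]
    intro s
    rw [Real.dist_eq]
    refine le_trans ?_ (hM.sum_abs_iterate_le π M.init.2 (M.push_mem π M.init.2) n)
    have := Finset.single_le_sum (f := fun s => |x n s - x (n + 1) s|)
      (fun i _ => abs_nonneg _) (Finset.mem_univ s)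
    simpa [x] using this
  obtain ⟨d, hd⟩ := cauchySeq_tendsto_of_complete hc
  refine ⟨d, (isClosed_stdSimplex ℝ S).mem_of_tendsto hd (Filter.Eventually.of_forall hx), ?_⟩
  have hp : Continuous (M.push π) := by unfold push; fun_prop
  refine tendsto_nhds_unique ?_ (hd.comp (Filter.tendsto_add_atTop_nat 1))
  refine ((hp.tendsto d).comp hd).congr fun n => ?_
  simp [x, Function.iterate_succ_apply']

theorem HasMixingTime.isStationary_statDist (hM : M.HasMixingTime τ) (hτ : 1 ≤ τ)
    (π : Policy S A) : M.IsStationary π (M.statDist π) := by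
  have h := hM.exists_isStationary hτ π
  rw [statDist, dif_pos h]
  exact h.choose_spec

theorem HasMixingTime.statDist_mem (hM : M.HasMixingTime τ) (hτ : 1 ≤ τ)
    (π : Policy S A) : M.statDist π ∈ stdSimplex ℝ S := (hM.isStationary_statDist hτ π).1

theorem HasMixingTime.push_statDist (hM : M.HasMixingTime τ) (hτ : 1 ≤ τ)
    (π : Policy S A) : M.push π (M.statDist π) = M.statDist π := (hM.isStationary_statDist hτ π).2

theorem sum_abs_push_sub_push_le (π π' : Policy S A) {δ : ℝ}
    (hδ : ∀ s, ∑ a, |(π s).1 a - (π' s).1 a| ≤ δ) {d : S → ℝ} (hd : d ∈ stdSimplex ℝ S) :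
    ∑ s, |M.push π d s - M.push π' d s| ≤ δ := by
  calc ∑ s', |M.push π d s' - M.push π' d s'|
      = ∑ s', |∑ s, ∑ a, d s * (((π s).1 a - (π' s).1 a) * (M.trans s a).1 s')| := by
        refine Finset.sum_congr rfl fun s' _ => ?_
        simp only [push, transMatrix, ← Finset.sum_sub_distrib, ← mul_sub, ← sub_mul,
          ← Finset.mul_sum]
    _ ≤ ∑ s', ∑ s, ∑ a, d s * (|(π s).1 a - (π' s).1 a| * (M.trans s a).1 s') := by
        gcongr with s' _
        refine (Finset.abs_sum_le_sum_abs _ _).trans (Finset.sum_le_sum fun s _ => ?_)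
        refine (Finset.abs_sum_le_sum_abs _ _).trans (Finset.sum_le_sum fun a _ => ?_)
        rw [abs_mul, abs_mul, abs_of_nonneg (hd.1 s), abs_of_nonneg ((M.trans s a).2.1 s')]
    _ = ∑ s, d s * ∑ a, |(π s).1 a - (π' s).1 a| := by
        rw [Finset.sum_comm]
        refine Finset.sum_congr rfl fun s _ => ?_
        rw [Finset.sum_comm, Finset.mul_sum]
        refine Finset.sum_congr rfl fun a _ => ?_
        rw [← Finset.mul_sum, ← Finset.mul_sum, (M.trans s a).2.2, mul_one]
    _ ≤ ∑ s, d s * δ := by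
        gcongr with s
        · exact hd.1 s
        · exact hδ s
    _ = δ := by rw [← Finset.sum_mul, hd.2, one_mul]

/-- Passing through the push of the second stationary law under the first policy gives x ≤ e^{-1/τ}
x + δ for the distance x, and the contraction solves this for x. -/
theorem HasMixingTime.sum_abs_statDist_sub_le (hM : M.HasMixingTime τ) (hτ : 1 ≤ τ)
    (π π' : Policy S A) {δ : ℝ} (hδ : ∀ s, ∑ a, |(π s).1 a - (π' s).1 a| ≤ δ) :
    ∑ s, |M.statDist π s - M.statDist π' s| ≤ 2 * τ * δ := by
  set x := ∑ s, |M.statDist π s - M.statDist π' s| with hx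
  have hd := hM.statDist_mem hτ π
  have hd' := hM.statDist_mem hτ π'
  have h1 : x ≤ Real.exp (-1 / τ) * x + δ := by
    calc x = ∑ s, |M.push π (M.statDist π) s - M.push π' (M.statDist π') s| := by
          rw [hM.push_statDist hτ, hM.push_statDist hτ]
      _ ≤ ∑ s, (|M.push π (M.statDist π) s - M.push π (M.statDist π') s|
            + |M.push π (M.statDist π') s - M.push π' (M.statDist π') s|) := by
          gcongr with s
          exact abs_sub_le _ _ _
      _ ≤ _ := by
          rw [Finset.sum_add_distrib]
          exact add_le_add (hM π _ hd _ hd') (sum_abs_push_sub_push_le π π' hδ hd')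
  have hx0 : 0 ≤ x := Finset.sum_nonneg fun s _ => abs_nonneg _
  have h2 := one_le_two_mul_mul_one_sub_exp hτ
  nlinarith

/-! ### Trajectory losses versus stationary losses. -/

variable (M)

/-- The law of the state in each round when the policies `π` are used. -/
def stateLaw (π : ℕ → Policy S A) : ℕ → S → ℝ
  | 0 => M.init.1
  | n + 1 => M.push (π n) (stateLaw π n)

theorem stateLaw_mem (π : ℕ → Policy S A) (n : ℕ) : M.stateLaw π n ∈ stdSimplex ℝ S := by
  induction n with
  | zero => exact M.init.2
  | succ n ih => exact M.push_mem _ ih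

theorem avgLoss_eq (l : S → A → ℝ) (π : Policy S A) :
    M.avgLoss l π = ∑ s, M.statDist π s * ∑ a, (π s).1 a * l s a := by
  simp only [avgLoss, Finset.mul_sum, mul_assoc]

theorem avgLoss_sum {ι : Type*} (J : Finset ι) (l : ι → S → A → ℝ) (π : Policy S A) :
    M.avgLoss (∑ j ∈ J, l j) π = ∑ j ∈ J, M.avgLoss (l j) π := by
  simp only [avgLoss, Finset.sum_apply, Finset.mul_sum]
  rw [Finset.sum_comm (s := J)]
  refine Finset.sum_congr rfl fun s _ => ?_
  rw [Finset.sum_comm]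

theorem avgLoss_smul (c : ℝ) (l : S → A → ℝ) (π : Policy S A) :
    M.avgLoss (c • l) π = c * M.avgLoss l π := by
  simp only [avgLoss, Pi.smul_apply, smul_eq_mul, Finset.mul_sum]
  refine Finset.sum_congr rfl fun s _ => Finset.sum_congr rfl fun a _ => ?_
  ring

theorem sum_push_mul (π : Policy S A) (d h : S → ℝ) :
    ∑ s, M.push π d s * h s
      = ∑ s, d s * ∑ a, (π s).1 a * ∑ s', (M.trans s a).1 s' * h s' := by
  simp only [push, transMatrix, Finset.sum_mul, Finset.mul_sum]
  rw [Finset.sum_comm]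
  refine Finset.sum_congr rfl fun s _ => ?_
  rw [Finset.sum_comm]
  simp only [mul_assoc]

theorem sum_snoc {X : Type*} [Fintype X] (n : ℕ) (F : (Fin (n + 1) → X) → ℝ) :
    ∑ ω, F ω = ∑ ω : Fin n → X, ∑ x, F (Fin.snoc ω x) := by
  rw [← (Fin.snocEquiv fun _ => X).sum_comp, Fintype.sum_prod_type, Finset.sum_comm]
  rfl

theorem trajProb_succ_succ_snoc (π : ℕ → Policy S A) (n : ℕ) (ω : Fin (n + 1) → S × A)
    (z : S × A) : M.trajProb π (n + 2) (Fin.snoc ω z) = M.trajProb π (n + 1) ω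
      * ((M.trans (ω (Fin.last n)).1 (ω (Fin.last n)).2).1 z.1 * (π (n + 1) z.1).1 z.2) := by
  rw [trajProb, Fin.snoc_last, Fin.snoc_castSucc, Fin.init_snoc]
  ring

/-- Only the marginal of the last pair matters. The induction is over all g at once, because
averaging g over the last step gives a new function of the previous pair. -/
theorem sum_trajProb_last (π : ℕ → Policy S A) (n : ℕ) (g : S → A → ℝ) :
    ∑ ω : Fin (n + 1) → S × A,
      M.trajProb π (n + 1) ω * g (ω (Fin.last n)).1 (ω (Fin.last n)).2
      = ∑ s, M.stateLaw π n s * ∑ a, (π n s).1 a * g s a := by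
  induction n generalizing g with
  | zero =>
    rw [sum_snoc]
    simp [trajProb, stateLaw, Fintype.sum_prod_type, Fin.snoc, Finset.mul_sum, mul_assoc]
  | succ n ih =>
    rw [sum_snoc]
    simp only [trajProb_succ_succ_snoc, Fin.snoc_last, mul_assoc, ← Finset.mul_sum]
    rw [ih fun s a => ∑ z : S × A, (M.trans s a).1 z.1 * ((π (n + 1) z.1).1 z.2 * g z.1 z.2)]
    rw [stateLaw, sum_push_mul]
    simp only [Fintype.sum_prod_type, Finset.mul_sum]

theorem sum_trajProb_init (π : ℕ → Policy S A) (n : ℕ) (F : (Fin n → S × A) → ℝ) :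
    ∑ ω : Fin (n + 1) → S × A, M.trajProb π (n + 1) ω * F (Fin.init ω)
      = ∑ ω, M.trajProb π n ω * F ω := by
  rw [sum_snoc]
  refine Finset.sum_congr rfl fun ω _ => ?_
  simp only [Fin.init_snoc, ← Finset.sum_mul]
  congr 1
  cases n with
  | zero =>
    simp [trajProb, Fintype.sum_prod_type, Fin.snoc, ← Finset.mul_sum, (π 0 _).2.2, M.init.2.2]
  | succ n =>
    simp only [trajProb_succ_succ_snoc, ← Finset.mul_sum, Fintype.sum_prod_type, (π _ _).2.2,
      (M.trans _ _).2.2, mul_one]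

theorem expectedLoss_eq (π : ℕ → Policy S A) (l : ℕ → S → A → ℝ) (T : ℕ) :
    M.expectedLoss π l T
      = ∑ t ∈ Finset.range T, ∑ s, M.stateLaw π t s * ∑ a, (π t s).1 a * l t s a := by
  induction T with
  | zero => simp [expectedLoss]
  | succ T ih =>
    rw [Finset.sum_range_succ, ← ih, ← sum_trajProb_last, expectedLoss, expectedLoss,
      ← M.sum_trajProb_init π T (fun ω => ∑ t : Fin T, l t (ω t).1 (ω t).2),
      ← Finset.sum_add_distrib]
    refine Finset.sum_congr rfl fun ω _ => ?_
    rw [Fin.sum_univ_castSucc, mul_add]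
    rfl

variable {M}

/-- The distance x to the current stationary law obeys x (t+1) ≤ e^{-1/τ} x t + y t, with y the
drift; summing and using x 0 ≤ 2 gives the bound. -/
theorem HasMixingTime.sum_stateLaw_sub_le (hM : M.HasMixingTime τ) (hτ : 1 ≤ τ)
    (π : ℕ → Policy S A) (T : ℕ) :
    ∑ t ∈ Finset.range (T + 1), ∑ s, |M.stateLaw π t s - M.statDist (π t) s|
      ≤ 2 * τ * (2 + ∑ t ∈ Finset.range T,
        ∑ s, |M.statDist (π t) s - M.statDist (π (t + 1)) s|) := by
  set x : ℕ → ℝ := fun t => ∑ s, |M.stateLaw π t s - M.statDist (π t) s| with hx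
  set y : ℕ → ℝ := fun t => ∑ s, |M.statDist (π t) s - M.statDist (π (t + 1)) s| with hy
  have hx0 : ∀ t, 0 ≤ x t := fun t => Finset.sum_nonneg fun s _ => abs_nonneg _
  have hstep : ∀ t, x (t + 1) ≤ Real.exp (-1 / τ) * x t + y t := by
    intro t
    calc x (t + 1) ≤ ∑ s, (|M.stateLaw π (t + 1) s - M.statDist (π t) s|
            + |M.statDist (π t) s - M.statDist (π (t + 1)) s|) := by
          simp only [hx]
          gcongr with s
          exact abs_sub_le _ _ _
      _ ≤ _ := by
          rw [Finset.sum_add_distrib]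
          gcongr
          have := hM (π t) _ (M.stateLaw_mem π t) _ (hM.statDist_mem hτ (π t))
          rwa [hM.push_statDist hτ] at this
  have hzero : x 0 ≤ 2 := sum_abs_sub_le_two (M.stateLaw_mem π 0) (hM.statDist_mem hτ _)
  have h2 := one_le_two_mul_mul_one_sub_exp hτ
  have key : (1 - Real.exp (-1 / τ)) * ∑ t ∈ Finset.range (T + 1), x t
      ≤ 2 + ∑ t ∈ Finset.range T, y t := by
    -- The extra term e^{-1/τ} x n is what the next use of the recursion consumes; it is dropped at
    -- the end.
    have : ∀ n, (1 - Real.exp (-1 / τ)) * ∑ t ∈ Finset.range (n + 1), x t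
      + Real.exp (-1 / τ) * x n ≤ 2 + ∑ t ∈ Finset.range n, y t := by
      intro n
      induction n with
      | zero => simp; linarith
      | succ n ih =>
        rw [Finset.sum_range_succ, Finset.sum_range_succ y]
        linarith [hstep n]
    have h := this T
    have := mul_nonneg (Real.exp_pos (-1 / τ)).le (hx0 T)
    linarith
  have hX : 0 ≤ ∑ t ∈ Finset.range (T + 1), x t := Finset.sum_nonneg fun t _ => hx0 t
  calc ∑ t ∈ Finset.range (T + 1), x t
      ≤ 2 * τ * (1 - Real.exp (-1 / τ)) * ∑ t ∈ Finset.range (T + 1), x t :=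
        le_mul_of_one_le_left hX h2
    _ = 2 * τ * ((1 - Real.exp (-1 / τ)) * ∑ t ∈ Finset.range (T + 1), x t) := by ring
    _ ≤ _ := by gcongr

theorem HasMixingTime.abs_expectedLoss_sub_le (hM : M.HasMixingTime τ) (hτ : 1 ≤ τ)
    (π : ℕ → Policy S A) {l : ℕ → S → A → ℝ} (hl : ∀ t s a, l t s a ∈ Set.Icc (0 : ℝ) 1) (T : ℕ) :
    |M.expectedLoss π l (T + 1) - ∑ t ∈ Finset.range (T + 1), M.avgLoss (l t) (π t)|
      ≤ 2 * τ * (2 + ∑ t ∈ Finset.range T,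
        ∑ s, |M.statDist (π t) s - M.statDist (π (t + 1)) s|) := by
  refine le_trans ?_ (hM.sum_stateLaw_sub_le hτ π T)
  rw [expectedLoss_eq, ← Finset.sum_sub_distrib]
  refine (Finset.abs_sum_le_sum_abs _ _).trans (Finset.sum_le_sum fun t _ => ?_)
  rw [avgLoss_eq]
  refine abs_sum_mul_sub_le (fun s => ?_) _ _
  have := sum_mul_mem_Icc (π t s).2 (hl t s)
  rw [abs_le]
  exact ⟨by linarith [this.1], this.2⟩

end OnlineMDP

/-! ### The function Q, performance differences and best responses. -/

theorem sum_detPolicy_mul {S A : Type*} [Fintype A] (f : S → A) (s : S) (g : A → ℝ) :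
    ∑ a, (detPolicy f s).1 a * g a = g (f s) := by
  classical
  rw [Finset.sum_eq_single (f s)]
  · simp [detPolicy]
  · intro b _ hb
    simp [detPolicy, Pi.single_eq_of_ne hb]
  · simp

namespace OnlineMDP

variable {S A : Type*} [Fintype S] [Fintype A] {M : OnlineMDP S A} {τ : ℝ}

/-- After the first step actions are drawn from π, so the law of the pair is a state law times π and
the contraction on states applies. -/
theorem lawFrom_succ_apply (π : Policy S A) (s : S) (a : A) (n : ℕ) (z : S × A) :
    M.lawFrom π s a (n + 1) z = (M.push π)^[n] (M.trans s a).1 z.1 * (π z.1).1 z.2 := by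
  classical
  induction n generalizing z with
  | zero =>
    simp only [lawFrom, zero_add, Function.iterate_one, stepSA, Function.iterate_zero, id]
    congr 1
    rw [Finset.sum_eq_single (s, a)]
    · simp
    · intro y _ hy
      rw [Pi.single_eq_of_ne hy, zero_mul]
    · simp
  | succ n ih =>
    have : M.lawFrom π s a (n + 2) z = M.stepSA π (M.lawFrom π s a (n + 1)) z := by
      simp only [lawFrom]
      rw [Function.iterate_succ_apply']
    rw [this, stepSA, Function.iterate_succ_apply', push]
    congr 1
    simp only [ih, Fintype.sum_prod_type, transMatrix, Finset.mul_sum, mul_assoc]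

/-- The sum over time of the expected excess loss when the first state has law `d` and actions
are drawn from `π`. -/
def biasSum (M : OnlineMDP S A) (π : Policy S A) (l : S → A → ℝ) (d : S → ℝ) : ℝ :=
  ∑' n : ℕ, (∑ s, (M.push π)^[n] d s * (∑ a, (π s).1 a * l s a) - M.avgLoss l π)

theorem HasMixingTime.abs_biasSum_term_le (hM : M.HasMixingTime τ) (hτ : 1 ≤ τ) (π : Policy S A)
    {l : S → A → ℝ} (hl : ∀ s a, l s a ∈ Set.Icc (0 : ℝ) 1) {d : S → ℝ} (hd : d ∈ stdSimplex ℝ S)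
    (n : ℕ) :
    |∑ s, (M.push π)^[n] d s * (∑ a, (π s).1 a * l s a) - M.avgLoss l π|
      ≤ 2 * Real.exp (-1 / τ) ^ n := by
  have hfix : (M.push π)^[n] (M.statDist π) = M.statDist π :=
    Function.iterate_fixed (hM.push_statDist hτ π) n
  refine le_trans ?_ (hM.sum_abs_iterate_le π hd (hM.statDist_mem hτ π) n)
  rw [hfix, avgLoss_eq]
  refine abs_sum_mul_sub_le (fun s => ?_) _ _
  have := sum_mul_mem_Icc (π s).2 (hl s)
  rw [abs_le]
  exact ⟨by linarith [this.1], this.2⟩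

theorem HasMixingTime.summable_biasSum (hM : M.HasMixingTime τ) (hτ : 1 ≤ τ) (π : Policy S A)
    {l : S → A → ℝ} (hl : ∀ s a, l s a ∈ Set.Icc (0 : ℝ) 1) {d : S → ℝ}
    (hd : d ∈ stdSimplex ℝ S) :
    Summable fun n : ℕ =>
      ∑ s, (M.push π)^[n] d s * (∑ a, (π s).1 a * l s a) - M.avgLoss l π :=
  Summable.of_norm_bounded
    ((summable_geometric_of_lt_one (Real.exp_pos _).le (exp_rate_lt_one hτ)).mul_left 2)
    (hM.abs_biasSum_term_le hτ π hl hd)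

theorem HasMixingTime.abs_biasSum_le (hM : M.HasMixingTime τ) (hτ : 1 ≤ τ) (π : Policy S A)
    {l : S → A → ℝ} (hl : ∀ s a, l s a ∈ Set.Icc (0 : ℝ) 1) {d : S → ℝ}
    (hd : d ∈ stdSimplex ℝ S) : |M.biasSum π l d| ≤ 4 * τ := by
  have hg := (hasSum_geometric_of_lt_one (Real.exp_pos (-1 / τ)).le
    (exp_rate_lt_one hτ)).mul_left 2
  rw [← Real.norm_eq_abs, biasSum]
  refine (tsum_of_norm_bounded hg fun n => hM.abs_biasSum_term_le hτ π hl hd n).trans ?_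
  have h1 := one_le_two_mul_mul_one_sub_exp hτ
  have h2 : 0 < 1 - Real.exp (-1 / τ) := by linarith [exp_rate_lt_one hτ]
  rw [← div_eq_mul_inv, div_le_iff₀ h2]
  linarith

/-- Bellman equation: the time-zero term is split off, and the rest is the bias of the chain started
from P(· | s, a). -/
theorem HasMixingTime.Q_eq (hM : M.HasMixingTime τ) (hτ : 1 ≤ τ) (π : Policy S A)
    {l : S → A → ℝ} (hl : ∀ s a, l s a ∈ Set.Icc (0 : ℝ) 1) (s : S) (a : A) :
    M.Q π l s a = l s a - M.avgLoss l π + M.biasSum π l (M.trans s a).1 := by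
  classical
  have hterm : ∀ n, (∑ z, M.lawFrom π s a (n + 1) z * l z.1 z.2) - M.avgLoss l π
      = ∑ s', (M.push π)^[n] (M.trans s a).1 s' * (∑ a, (π s').1 a * l s' a)
        - M.avgLoss l π := by
    intro n
    simp only [lawFrom_succ_apply, Fintype.sum_prod_type, mul_assoc, ← Finset.mul_sum]
  have hsum : Summable fun n : ℕ =>
      (∑ z, M.lawFrom π s a (n + 1) z * l z.1 z.2) - M.avgLoss l π := by
    simp only [hterm]
    exact hM.summable_biasSum hτ π hl (M.trans s a).2
  have hzero : ∑ z, M.lawFrom π s a 0 z * l z.1 z.2 = l s a := by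
    simp only [lawFrom, Function.iterate_zero, id]
    rw [Finset.sum_eq_single (s, a)]
    · simp
    · intro y _ hy
      rw [Pi.single_eq_of_ne hy, zero_mul]
    · simp
  have hQ := ((summable_nat_add_iff (f := fun n : ℕ =>
    (∑ z, M.lawFrom π s a n z * l z.1 z.2) - M.avgLoss l π) 1).1 hsum).tsum_eq_zero_add
  rw [Q, hQ, hzero, tsum_congr hterm, biasSum]

theorem HasMixingTime.avgLoss_mem_Icc (hM : M.HasMixingTime τ) (hτ : 1 ≤ τ) (π : Policy S A)
    {l : S → A → ℝ} (hl : ∀ s a, l s a ∈ Set.Icc (0 : ℝ) 1) :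
    M.avgLoss l π ∈ Set.Icc (0 : ℝ) 1 := by
  rw [avgLoss_eq]
  exact sum_mul_mem_Icc (hM.statDist_mem hτ π) fun s => sum_mul_mem_Icc (π s).2 (hl s)

theorem HasMixingTime.abs_Q_le (hM : M.HasMixingTime τ) (hτ : 1 ≤ τ) (π : Policy S A)
    {l : S → A → ℝ} (hl : ∀ s a, l s a ∈ Set.Icc (0 : ℝ) 1) (s : S) (a : A) :
    |M.Q π l s a| ≤ 5 * τ := by
  rw [hM.Q_eq hτ π hl]
  have h1 := abs_le.1 (hM.abs_biasSum_le hτ π hl (M.trans s a).2)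
  have h2 := hM.avgLoss_mem_Icc hτ π hl
  have h3 := hl s a
  rw [abs_le]
  constructor <;> linarith [h1.1, h1.2, h2.1, h2.2, h3.1, h3.2]

/-- The bias sum is additive in the initial law, so it is an average over the first state. -/
theorem HasMixingTime.biasSum_eq (hM : M.HasMixingTime τ) (hτ : 1 ≤ τ) (π : Policy S A)
    {l : S → A → ℝ} (hl : ∀ s a, l s a ∈ Set.Icc (0 : ℝ) 1) {d : S → ℝ}
    (hd : d ∈ stdSimplex ℝ S) :
    M.biasSum π l d = ∑ s, d s * ∑ a, (π s).1 a * M.Q π l s a := by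
  -- Condition on the first state and action. Summing over n then produces the bias part of Q, and
  -- the separate n = 0 term produces its immediate excess loss.
  have hlin : ∀ n, (∑ s', (M.push π)^[n + 1] d s' * (∑ a, (π s').1 a * l s' a) - M.avgLoss l π)
      = ∑ s, d s * ∑ a, (π s).1 a *
        (∑ s', (M.push π)^[n] (M.trans s a).1 s' * (∑ a, (π s').1 a * l s' a)
          - M.avgLoss l π) := by
    intro n
    have h1 : ∀ (n : ℕ) (d : S → ℝ) (h : S → ℝ), ∑ s', (M.push π)^[n + 1] d s' * h s'
        = ∑ s, d s * ∑ a, (π s).1 a * ∑ s', (M.push π)^[n] (M.trans s a).1 s' * h s' := by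
      intro n
      induction n with
      | zero => intro d h; simpa using M.sum_push_mul π d h
      | succ n ih =>
        intro d h
        rw [Function.iterate_succ_apply', sum_push_mul, ih]
        simp only [Function.iterate_succ_apply' _ n, sum_push_mul]
    rw [h1]
    simp only [mul_sub, Finset.sum_sub_distrib, ← Finset.sum_mul, (π _).2.2, one_mul, hd.2]
  have hs := fun s a => hM.summable_biasSum hτ π hl (M.trans s a).2
  rw [biasSum, (hM.summable_biasSum hτ π hl hd).tsum_eq_zero_add]
  simp only [hlin]
  rw [Summable.tsum_finsetSum fun s _ =>
    (summable_sum fun a _ => (hs s a).mul_left _).mul_left _]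
  have : ∀ s, ∑' n : ℕ, d s * ∑ a, (π s).1 a *
      (∑ s', (M.push π)^[n] (M.trans s a).1 s' * (∑ a, (π s').1 a * l s' a) - M.avgLoss l π)
      = d s * ∑ a, (π s).1 a * M.biasSum π l (M.trans s a).1 := by
    intro s
    rw [tsum_mul_left, Summable.tsum_finsetSum fun a _ => (hs s a).mul_left _]
    simp only [tsum_mul_left, biasSum]
  rw [Finset.sum_congr rfl fun s _ => this s]
  simp only [hM.Q_eq hτ π hl, mul_add, mul_sub, Finset.sum_add_distrib,
    Finset.sum_sub_distrib, ← Finset.sum_mul, (π _).2.2, one_mul, hd.2, Function.iterate_zero, id]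

/-- The performance difference identity. -/
theorem HasMixingTime.avgLoss_sub_avgLoss (hM : M.HasMixingTime τ) (hτ : 1 ≤ τ)
    (π ρ : Policy S A) {l : S → A → ℝ} (hl : ∀ s a, l s a ∈ Set.Icc (0 : ℝ) 1) :
    M.avgLoss l π - M.avgLoss l ρ
      = ∑ s, M.statDist ρ s *
        (∑ a, (π s).1 a * M.Q π l s a - ∑ a, (ρ s).1 a * M.Q π l s a) := by
  have hd := hM.statDist_mem hτ ρ
  have h1 : ∑ s, M.statDist ρ s * ∑ a, (ρ s).1 a * M.Q π l s a
      = M.avgLoss l ρ - M.avgLoss l π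
        + ∑ s, M.statDist ρ s * ∑ a, (π s).1 a * M.Q π l s a := by
    -- With V(s) the π-average of Q(s, ·), averaging the Bellman equation under ρ leaves the mean of
    -- V one step ahead; stationarity of ρ equates it with the mean of V now.
    have h2 := M.sum_push_mul ρ (M.statDist ρ) fun s => ∑ a, (π s).1 a * M.Q π l s a
    rw [hM.push_statDist hτ] at h2
    rw [h2, M.avgLoss_eq l ρ]
    conv_lhs => simp only [hM.Q_eq hτ π hl]
    simp only [hM.biasSum_eq hτ π hl (M.trans _ _).2, mul_add, mul_sub, Finset.sum_add_distrib,
      Finset.sum_sub_distrib, ← Finset.sum_mul, (ρ _).2.2, one_mul, hd.2]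
  simp only [mul_sub, Finset.sum_sub_distrib]
  rw [h1]
  ring

/-- Policy improvement: take g greedy for the Q of ρ; every term of the performance difference
identity is then nonnegative. -/
theorem HasMixingTime.exists_detPolicy_le (hM : M.HasMixingTime τ) (hτ : 1 ≤ τ) (ρ : Policy S A)
    {l : S → A → ℝ} (hl : ∀ s a, l s a ∈ Set.Icc (0 : ℝ) 1) :
    ∃ g : S → A, M.avgLoss l (detPolicy g) ≤ M.avgLoss l ρ := by
  have hne : S → Nonempty A := by
    intro s
    by_contra h
    have := not_nonempty_iff.1 h
    simpa using (ρ s).2.2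
  choose g hg using fun s => haveI := hne s; Finite.exists_min (M.Q ρ l s)
  refine ⟨g, ?_⟩
  rw [← sub_nonneg, hM.avgLoss_sub_avgLoss hτ ρ _ hl]
  refine Finset.sum_nonneg fun s _ => mul_nonneg ((hM.statDist_mem hτ _).1 s) ?_
  rw [sum_detPolicy_mul, sub_nonneg]
  calc M.Q ρ l s (g s) = ∑ a, (ρ s).1 a * M.Q ρ l s (g s) := by
        rw [← Finset.sum_mul, (ρ s).2.2, one_mul]
    _ ≤ _ := by
        gcongr with a
        · exact (ρ s).2.1 a
        · exact hg s a

/-- A best response among deterministic policies to a sum of losses is a best response among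
all policies. -/
theorem HasMixingTime.sum_avgLoss_le_of_isBestResponse (hM : M.HasMixingTime τ) (hτ : 1 ≤ τ)
    {J : Finset ℕ} {l : ℕ → S → A → ℝ} (hl : ∀ j s a, l j s a ∈ Set.Icc (0 : ℝ) 1) {f : S → A}
    (hf : M.IsBestResponse (∑ j ∈ J, l j) f) (ρ : Policy S A) :
    ∑ j ∈ J, M.avgLoss (l j) (detPolicy f) ≤ ∑ j ∈ J, M.avgLoss (l j) ρ := by
  rcases J.eq_empty_or_nonempty with rfl | hJ
  · simp
  have hc : (0 : ℝ) < J.card := by exact_mod_cast hJ.card_pos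
  -- The sum is normalised to an average because the theory of Q is set up for losses in [0, 1].
  have hl' : ∀ s a, ((J.card : ℝ)⁻¹ • ∑ j ∈ J, l j) s a ∈ Set.Icc (0 : ℝ) 1 := by
    intro s a
    simp only [Pi.smul_apply, Finset.sum_apply, smul_eq_mul]
    refine ⟨mul_nonneg (by positivity) (Finset.sum_nonneg fun j _ => (hl j s a).1), ?_⟩
    rw [inv_mul_le_iff₀ hc, mul_one]
    simpa using Finset.sum_le_card_nsmul J _ 1 fun j _ => (hl j s a).2
  obtain ⟨g, hg⟩ := hM.exists_detPolicy_le hτ ρ hl'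
  rw [avgLoss_smul, avgLoss_smul] at hg
  have := le_of_mul_le_mul_left hg (by positivity)
  rw [← avgLoss_sum, ← avgLoss_sum]
  exact (hf g).trans this

end OnlineMDP

/-! ### Exponential weights: stability and potential. -/

theorem expWeights_of_mem {A : Type*} {F : Finset A} {a : A} (ha : a ∈ F) (μ : ℝ) (c : A → ℝ) :
    expWeights F μ c a = Real.exp (-μ * c a) / ∑ b ∈ F, Real.exp (-μ * c b) := by
  rw [expWeights, if_pos ha]

theorem expWeights_of_notMem {A : Type*} {F : Finset A} {a : A} (ha : a ∉ F) (μ : ℝ)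
    (c : A → ℝ) : expWeights F μ c a = 0 := by
  rw [expWeights, if_neg ha]

theorem sum_expWeights_mul {A : Type*} [Fintype A] (F : Finset A) (μ : ℝ) (c x : A → ℝ) :
    ∑ a, expWeights F μ c a * x a
      = (∑ a ∈ F, Real.exp (-μ * c a) * x a) / ∑ b ∈ F, Real.exp (-μ * c b) := by
  rw [← Finset.sum_subset (Finset.subset_univ F) fun a _ ha => by
    rw [expWeights_of_notMem ha, zero_mul], Finset.sum_div]
  refine Finset.sum_congr rfl fun a ha => ?_
  rw [expWeights_of_mem ha]
  ring

theorem sum_exp_pos {A : Type*} {F : Finset A} (hF : F.Nonempty) (g : A → ℝ) :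
    0 < ∑ b ∈ F, Real.exp (g b) :=
  Finset.sum_pos (fun _ _ => Real.exp_pos _) hF

theorem expWeights_nonneg {A : Type*} (F : Finset A) (μ : ℝ) (c : A → ℝ) (a : A) :
    0 ≤ expWeights F μ c a := by
  by_cases ha : a ∈ F
  · rw [expWeights_of_mem ha]
    exact div_nonneg (Real.exp_pos _).le (Finset.sum_nonneg fun _ _ => (Real.exp_pos _).le)
  · rw [expWeights_of_notMem ha]

theorem expWeights_mem {A : Type*} [Fintype A] {F : Finset A} (hF : F.Nonempty) (μ : ℝ)
    (c : A → ℝ) : expWeights F μ c ∈ stdSimplex ℝ A := by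
  refine ⟨expWeights_nonneg F μ c, ?_⟩
  have := sum_expWeights_mul F μ c fun _ => 1
  simp only [mul_one] at this
  rw [this, div_self (sum_exp_pos hF _).ne']

/-- One factor e^D comes from the numerator and one from the normaliser. -/
theorem expWeights_le_exp_mul {A : Type*} {F : Finset A} {μ μ' D : ℝ} {c c' : A → ℝ}
    (h : ∀ a ∈ F, |μ * c a - μ' * c' a| ≤ D) (a : A) :
    expWeights F μ c a ≤ Real.exp (2 * D) * expWeights F μ' c' a := by
  by_cases ha : a ∈ F
  · have hF : F.Nonempty := ⟨a, ha⟩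
    rw [expWeights_of_mem ha, expWeights_of_mem ha, ← mul_div_assoc,
      div_le_div_iff₀ (sum_exp_pos hF _) (sum_exp_pos hF _), two_mul, Real.exp_add]
    have h1 : Real.exp (-μ * c a) ≤ Real.exp D * Real.exp (-μ' * c' a) := by
      rw [← Real.exp_add]
      gcongr
      linarith [(abs_le.1 (h a ha)).1]
    have h2 : ∑ b ∈ F, Real.exp (-μ' * c' b) ≤ Real.exp D * ∑ b ∈ F, Real.exp (-μ * c b) := by
      rw [Finset.mul_sum]
      refine Finset.sum_le_sum fun b hb => ?_
      rw [← Real.exp_add]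
      gcongr
      linarith [(abs_le.1 (h b hb)).2]
    calc _ ≤ (Real.exp D * Real.exp (-μ' * c' a)) * (Real.exp D * ∑ b ∈ F, Real.exp (-μ * c b)) :=
          mul_le_mul h1 h2 (sum_exp_pos hF _).le (by positivity)
      _ = _ := by ring
  · rw [expWeights_of_notMem ha, expWeights_of_notMem ha, mul_zero]

theorem sum_abs_expWeights_sub_le {A : Type*} [Fintype A] {F : Finset A} (hF : F.Nonempty)
    {μ μ' D : ℝ} {c c' : A → ℝ} (h : ∀ a ∈ F, |μ * c a - μ' * c' a| ≤ D) :
    ∑ a, |expWeights F μ c a - expWeights F μ' c' a| ≤ 4 * D := by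
  have hD : 0 ≤ D := (abs_nonneg _).trans (h _ hF.choose_spec)
  have hm := expWeights_mem hF μ c
  have hm' := expWeights_mem hF μ' c'
  -- For 2D ≤ 1 the weights agree up to a factor e^{2D}, and e^{2D} - 1 ≤ 4D; otherwise the trivial
  -- bound 2 is below 4D.
  rcases le_or_gt (2 * D) 1 with h1 | h1
  · have he : Real.exp (2 * D) - 1 ≤ 4 * D := by
      have := Real.abs_exp_sub_one_le (x := 2 * D) (by rwa [abs_of_nonneg (by linarith)])
      rw [abs_of_nonneg (a := 2 * D) (by linarith)] at this
      linarith [le_abs_self (Real.exp (2 * D) - 1)]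
    have he' : 1 - Real.exp (-(2 * D)) ≤ Real.exp (2 * D) - 1 := by
      linarith [Real.add_one_le_exp (2 * D), Real.add_one_le_exp (-(2 * D))]
    calc _ ≤ ∑ a, (4 * D) * expWeights F μ c a := by
          refine Finset.sum_le_sum fun a _ => ?_
          have hp := expWeights_nonneg F μ c a
          have h2 := expWeights_le_exp_mul h a
          have h3 := expWeights_le_exp_mul (fun a ha => abs_sub_comm (μ * c a) _ ▸ h a ha) a
          have h4 : Real.exp (-(2 * D)) * expWeights F μ c a ≤ expWeights F μ' c' a := by
            rw [Real.exp_neg, inv_mul_le_iff₀ (Real.exp_pos _)]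
            exact h2
          rw [abs_le]
          constructor <;> nlinarith
      _ = 4 * D := by rw [← Finset.mul_sum, hm.2, mul_one]
  · linarith [sum_abs_sub_le_two hm hm']

/-- A weak form of Hoeffding's lemma, with B²/2 in place of B²/8, from a quadratic bound on e^{-y}.
That bound needs y ≥ 0, so the values are shifted by their lower bound b. -/
theorem sum_mul_exp_neg_le {A : Type*} {F : Finset A} {p x : A → ℝ} (hp : ∀ a ∈ F, 0 ≤ p a)
    (hp1 : ∑ a ∈ F, p a = 1) {b B η : ℝ} (hη : 0 ≤ η) (hx : ∀ a ∈ F, x a ∈ Set.Icc b (b + B)) :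
    ∑ a ∈ F, p a * Real.exp (-η * x a)
      ≤ Real.exp (-η * ∑ a ∈ F, p a * x a + η ^ 2 * B ^ 2 / 2) := by
  have hexp : ∀ y : ℝ, 0 ≤ y → Real.exp (-y) ≤ 1 - y + y ^ 2 / 2 := by
    intro y hy
    have h1 := Real.quadratic_le_exp_of_nonneg hy
    rw [Real.exp_neg, inv_le_iff_one_le_mul₀ (Real.exp_pos y)]
    -- The product (1 - y + y²/2)(1 + y + y²/2) equals 1 + y⁴/4.
    nlinarith [sq_nonneg y, sq_nonneg (y ^ 2), sq_nonneg (y - 1)]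
  have h1 : ∀ a ∈ F, p a * Real.exp (-η * x a)
      ≤ Real.exp (-η * b) * (p a * (1 + η ^ 2 * B ^ 2 / 2 + η * b) - η * (p a * x a)) := by
    intro a ha
    obtain ⟨hb1, hb2⟩ := hx a ha
    have h2 := hexp (η * (x a - b)) (mul_nonneg hη (by linarith))
    have h3 : (η * (x a - b)) ^ 2 ≤ η ^ 2 * B ^ 2 := by
      rw [mul_pow]
      gcongr
      · linarith
    calc p a * Real.exp (-η * x a)
        = Real.exp (-η * b) * (p a * Real.exp (-(η * (x a - b)))) := by
          rw [mul_left_comm, ← Real.exp_add]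
          ring_nf
      _ ≤ Real.exp (-η * b) * (p a * (1 - η * (x a - b) + η ^ 2 * B ^ 2 / 2)) := by
          gcongr
          · exact hp a ha
          · linarith
      _ = _ := by ring
  refine (Finset.sum_le_sum h1).trans ?_
  rw [← Finset.mul_sum, Finset.sum_sub_distrib, ← Finset.sum_mul, hp1, ← Finset.mul_sum]
  calc _ ≤ Real.exp (-η * b)
        * Real.exp (η ^ 2 * B ^ 2 / 2 + η * b - η * ∑ a ∈ F, p a * x a) := by
        gcongr
        linarith [Real.add_one_le_exp (η ^ 2 * B ^ 2 / 2 + η * b - η * ∑ a ∈ F, p a * x a)]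
    _ = _ := by
        rw [← Real.exp_add]
        ring_nf

/-- The potential `-(1 / η) log ((1 / |F|) ∑ exp (-η c))` of the exponential forecaster. -/
def mixPotential {A : Type*} (F : Finset A) (η : ℝ) (c : A → ℝ) : ℝ :=
  -(Real.log ((∑ b ∈ F, Real.exp (-η * c b)) / F.card) / η)

theorem mixPotential_zero {A : Type*} {F : Finset A} (hF : F.Nonempty) (η : ℝ) :
    mixPotential F η (fun _ => 0) = 0 := by
  have : (F.card : ℝ) ≠ 0 := by exact_mod_cast hF.card_pos.ne'
  simp [mixPotential, this]

/-- Power mean inequality with exponent η/η' ≥ 1. This is what permits a decreasing learning rate.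
-/
theorem mixPotential_antitone {A : Type*} {F : Finset A} (hF : F.Nonempty) {η η' : ℝ}
    (hη' : 0 < η') (h : η' ≤ η) (c : A → ℝ) : mixPotential F η c ≤ mixPotential F η' c := by
  have hN : (0 : ℝ) < F.card := by exact_mod_cast hF.card_pos
  have hη : 0 < η := hη'.trans_le h
  have h1 := Real.rpow_arith_mean_le_arith_mean_rpow F (fun _ => (F.card : ℝ)⁻¹)
    (fun b => Real.exp (-η' * c b)) (fun _ _ => by positivity)
    (by rw [Finset.sum_const, nsmul_eq_mul, mul_inv_cancel₀ hN.ne'])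
    (fun _ _ => (Real.exp_pos _).le) (p := η / η') ((one_le_div hη').2 h)
  rw [← Finset.mul_sum, ← Finset.mul_sum] at h1
  have h2 : ∀ b, Real.exp (-η' * c b) ^ (η / η') = Real.exp (-η * c b) := by
    intro b
    rw [← Real.exp_mul]
    congr 1
    field_simp
  simp only [h2] at h1
  have hp := sum_exp_pos hF fun b => -η' * c b
  have h3 := Real.log_le_log (by positivity) h1
  rw [Real.log_rpow (by positivity), inv_mul_eq_div, inv_mul_eq_div] at h3
  rw [mixPotential, mixPotential, neg_le_neg_iff, div_le_div_iff₀ hη' hη]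
  rw [div_mul_eq_mul_div, div_le_iff₀ hη'] at h3
  linarith

theorem mixPotential_le {A : Type*} {F : Finset A} {a : A} (ha : a ∈ F) {η : ℝ} (hη : 0 < η)
    (c : A → ℝ) : mixPotential F η c ≤ c a + Real.log F.card / η := by
  have hN : (0 : ℝ) < F.card := by exact_mod_cast Finset.card_pos.2 ⟨a, ha⟩
  have h1 : Real.exp (-η * c a) ≤ ∑ b ∈ F, Real.exp (-η * c b) :=
    Finset.single_le_sum (f := fun b => Real.exp (-η * c b)) (fun _ _ => (Real.exp_pos _).le) ha
  have h2 := Real.log_le_log (Real.exp_pos _) h1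
  rw [Real.log_exp] at h2
  rw [mixPotential, Real.log_div (sum_exp_pos ⟨a, ha⟩ _).ne' hN.ne', ← neg_div,
    div_le_iff₀ hη, add_mul, div_mul_cancel₀ _ hη.ne']
  linarith

/-- The ratio of successive normalisers is exactly the forecaster's mean of e^{-ηx}, so the
Hoeffding-type bound compares the mean loss with the increment of the potential. -/
theorem sum_expWeights_mul_le {A : Type*} [Fintype A] {F : Finset A} (hF : F.Nonempty) {η : ℝ}
    (hη : 0 < η) (c : A → ℝ) {x : A → ℝ} {b B : ℝ} (hx : ∀ a, x a ∈ Set.Icc b (b + B)) :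
    ∑ a, expWeights F η c a * x a
      ≤ mixPotential F η (fun a => c a + x a) - mixPotential F η c + η * B ^ 2 / 2 := by
  have hN : (0 : ℝ) < F.card := by exact_mod_cast hF.card_pos
  have hZ := sum_exp_pos hF fun a => -η * c a
  have hZ' := sum_exp_pos hF fun a => -η * (c a + x a)
  have hsum : ∀ y : A → ℝ, ∑ a ∈ F, expWeights F η c a * y a = ∑ a, expWeights F η c a * y a :=
    fun y => Finset.sum_subset (Finset.subset_univ F) fun a _ ha => by
      rw [expWeights_of_notMem ha, zero_mul]
  have h1 := sum_mul_exp_neg_le (F := F) (p := expWeights F η c) (x := x)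
    (fun a _ => expWeights_nonneg F η c a)
    (by simpa [(expWeights_mem hF η c).2] using hsum fun _ => 1) hη.le fun a _ => hx a
  rw [hsum, hsum, sum_expWeights_mul F η c fun a => Real.exp (-η * x a)] at h1
  simp only [← Real.exp_add, ← mul_add] at h1
  have h2 := Real.log_le_log (by positivity) h1
  rw [Real.log_exp, Real.log_div hZ'.ne' hZ.ne'] at h2
  rw [mixPotential, mixPotential, Real.log_div hZ'.ne' hN.ne', Real.log_div hZ.ne' hN.ne']
  have h3 : ∀ u v w m : ℝ, u - v ≤ -η * m + η ^ 2 * B ^ 2 / 2 →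
      m ≤ -((u - w) / η) - -((v - w) / η) + η * B ^ 2 / 2 := by
    intro u v w m h
    have : -((u - w) / η) - -((v - w) / η) + η * B ^ 2 / 2
        = (-(u - v) + η ^ 2 * B ^ 2 / 2) / η := by field_simp; ring
    rw [this, le_div_iff₀ hη]
    linarith
  exact h3 _ _ _ _ h2

/-! ### Rounds of one window and the forecaster's regret. -/

section Rounds

variable {S A : Type*} {E : ℕ → S → Finset A} {t : ℕ} {F : S → Finset A}

theorem mem_roundsWith {j : ℕ} : j ∈ roundsWith E t F ↔ j < t ∧ E (j + 1) = F := by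
  simp [roundsWith]

theorem roundsWith_zero : roundsWith E 0 F = ∅ := by
  simp [roundsWith]

theorem sum_roundsWith_succ_of_eq (h : E (t + 1) = F) (g : ℕ → ℝ) :
    ∑ j ∈ roundsWith E (t + 1) F, g j = ∑ j ∈ roundsWith E t F, g j + g t := by
  rw [roundsWith, Finset.range_add_one, Finset.filter_insert, if_pos h,
    Finset.sum_insert (by simp), add_comm, roundsWith]

theorem card_roundsWith_succ_of_eq (h : E (t + 1) = F) :
    (roundsWith E (t + 1) F).card = (roundsWith E t F).card + 1 := by
  rw [roundsWith, Finset.range_add_one, Finset.filter_insert, if_pos h,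
    Finset.card_insert_of_notMem (by simp), roundsWith]

theorem roundsWith_succ_of_ne (h : E (t + 1) ≠ F) :
    roundsWith E (t + 1) F = roundsWith E t F := by
  rw [roundsWith, Finset.range_add_one, Finset.filter_insert, if_neg h, roundsWith]

theorem sum_inv_sqrt_le (E : ℕ → S → Finset A) (F : S → Finset A) (t : ℕ) :
    ∑ j ∈ roundsWith E t F, 1 / √((roundsWith E j F).card + 1 : ℝ)
      ≤ 2 * √((roundsWith E t F).card : ℝ) := by
  induction t with
  | zero => simp [roundsWith_zero]
  | succ t ih =>
    by_cases h : E (t + 1) = F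
    · rw [sum_roundsWith_succ_of_eq h, card_roundsWith_succ_of_eq h]
      push_cast
      set n : ℝ := ((roundsWith E t F).card : ℝ)
      have hn : 0 ≤ n := Nat.cast_nonneg _
      have h1 : 0 < √(n + 1) := Real.sqrt_pos.2 (by linarith)
      have h2 : 1 / √(n + 1) ≤ 2 * √(n + 1) - 2 * √n := by
        rw [div_le_iff₀ h1]
        nlinarith [Real.sq_sqrt hn, Real.sq_sqrt (by linarith : 0 ≤ n + 1),
          sq_nonneg (√(n + 1) - √n)]
      linarith
    · rw [roundsWith_succ_of_ne h]
      exact ih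

/-- Regret of the exponentially weighted average forecaster, restricted to the rounds of a
window, with the time-varying learning rate of MDP-OOE. -/
theorem expWeights_regret_le [Fintype A] {F₀ : Finset A} {x p : ℕ → A → ℝ}
    (hx : ∀ j a, |x j a| ≤ 2)
    (hp : ∀ j, E (j + 1) = F → ∀ a, p j a =
      expWeights F₀ (√(8 * Real.log F₀.card / ((roundsWith E j F).card + 1)))
        (fun b => ∑ i ∈ roundsWith E j F, x i b) a) {a : A} (ha : a ∈ F₀) (t : ℕ) :
    ∑ j ∈ roundsWith E t F, (∑ b, p j b * x j b - x j a)
      ≤ 50 * √(Real.log F₀.card) * √((roundsWith E t F).card : ℝ) := by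
  have hF : F₀.Nonempty := ⟨a, ha⟩
  -- With a single expert the learning rate is 0 and the potential is useless, but the regret is
  -- exactly 0.
  rcases (Finset.one_le_card.2 hF).eq_or_lt with h1 | h1
  · have hs : F₀ = {a} := by
      obtain ⟨b, hb⟩ := Finset.card_eq_one.1 h1.symm
      rw [hb] at ha ⊢
      rw [Finset.mem_singleton.1 ha]
    rw [← h1, Finset.sum_eq_zero]
    · simp
    · intro j hj
      simp only [hp j (mem_roundsWith.1 hj).2]
      rw [sum_expWeights_mul, hs]
      simp
  · have hlog : 0 < Real.log F₀.card := Real.log_pos (by exact_mod_cast h1)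
    set K := √(8 * Real.log F₀.card) with hK
    have hK0 : 0 < K := Real.sqrt_pos.2 (by linarith)
    set η : ℕ → ℝ := fun t => K / √((roundsWith E t F).card + 1 : ℝ) with hη
    have hη0 : ∀ t, 0 < η t := fun t => div_pos hK0 (Real.sqrt_pos.2 (by positivity))
    have hp' : ∀ j, E (j + 1) = F → ∀ a, p j a =
        expWeights F₀ (η j) (fun b => ∑ i ∈ roundsWith E j F, x i b) a := by
      intro j hj a
      rw [hp j hj a, Real.sqrt_div (by linarith)]
    -- The potential telescopes: lowering the rate after each round of the window can only raise it.
    -- The 8 is B²/2 for a range of length B = 4.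
    have key : ∀ t, ∑ j ∈ roundsWith E t F, ∑ b, p j b * x j b
        ≤ mixPotential F₀ (η t) (fun b => ∑ i ∈ roundsWith E t F, x i b)
          + 8 * ∑ j ∈ roundsWith E t F, η j := by
      intro t
      induction t with
      | zero => simp [roundsWith_zero, mixPotential_zero hF]
      | succ t ih =>
        by_cases h : E (t + 1) = F
        · rw [sum_roundsWith_succ_of_eq h, sum_roundsWith_succ_of_eq h]
          simp only [fun b => sum_roundsWith_succ_of_eq h (fun i => x i b)]
          have h2 := sum_expWeights_mul_le hF (hη0 t) (fun b => ∑ i ∈ roundsWith E t F, x i b)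
            (x := x t) (b := -2) (B := 4) fun a => by
              have := abs_le.1 (hx t a)
              exact ⟨this.1, by linarith [this.2]⟩
          simp only [← hp' t h] at h2
          have h3 : η (t + 1) ≤ η t := by
            simp only [hη, card_roundsWith_succ_of_eq h]
            push_cast
            gcongr
            linarith
          have h4 := mixPotential_antitone hF (hη0 (t + 1)) h3
            fun b => ∑ i ∈ roundsWith E t F, x i b + x t b
          linarith
        · have h5 : η (t + 1) = η t := by simp only [hη, roundsWith_succ_of_ne h]
          rw [roundsWith_succ_of_ne h, h5]
          exact ih
    rcases (roundsWith E t F).card.eq_zero_or_pos with hn | hn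
    · rw [hn, Finset.card_eq_zero.1 hn]
      simp
    · rw [Finset.sum_sub_distrib]
      have h2 := mixPotential_le ha (hη0 t) fun b => ∑ i ∈ roundsWith E t F, x i b
      have h3 : ∑ j ∈ roundsWith E t F, η j ≤ K * (2 * √((roundsWith E t F).card : ℝ)) := by
        refine le_trans (le_of_eq ?_) (mul_le_mul_of_nonneg_left (sum_inv_sqrt_le E F t) hK0.le)
        rw [Finset.mul_sum]
        simp only [hη, mul_one_div]
      have hn' : (1 : ℝ) ≤ (roundsWith E t F).card := by exact_mod_cast hn
      set n : ℝ := ((roundsWith E t F).card : ℝ)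
      have hKe : K = √8 * √(Real.log F₀.card) := Real.sqrt_mul (by norm_num) _
      have h8 : √8 ≤ (2.83 : ℝ) := by
        rw [Real.sqrt_le_left (by norm_num)]
        norm_num
      have h8' : (2 : ℝ) ≤ √8 := by
        apply Real.le_sqrt_of_sq_le
        norm_num
      have hs := Real.sqrt_pos.2 hlog
      have hs2 := Real.sq_sqrt hlog.le
      have h4 : Real.log F₀.card / η t ≤ √(Real.log F₀.card) * √n := by
        have h5 : √(n + 1) ≤ 2 * √n := by
          rw [Real.sqrt_le_left (by positivity), mul_pow, Real.sq_sqrt (by linarith)]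
          linarith
        have h6 : Real.log F₀.card / η t = √(Real.log F₀.card) * (√(n + 1) / √8) := by
          simp only [hη, hKe]
          rw [div_div_eq_mul_div, mul_comm √8, mul_div_mul_comm]
          congr 1
          rw [div_eq_iff hs.ne', ← sq, hs2]
        rw [h6]
        gcongr
        rw [div_le_iff₀ (by linarith)]
        nlinarith [Real.sqrt_nonneg n]
      -- 16√8 < 46; the term log/η adds at most 1 more, which leaves room below 50.
      have h7 : 8 * (K * (2 * √n)) ≤ 46 * (√(Real.log F₀.card) * √n) := by
        rw [hKe]
        nlinarith [mul_nonneg hs.le (Real.sqrt_nonneg n)]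
      have h9 := mul_nonneg hs.le (Real.sqrt_nonneg n)
      linarith [key t]

/-- One round changes rate times cumulative loss in two ways: the new loss y enters, and the rate
drops on a sum of size at most 2n. The drop times n is at most one rate, so each effect costs at
most two rates. -/
theorem rate_drift_le {n K c y : ℝ} (hn : 0 ≤ n) (hK : 0 ≤ K) (hc : |c| ≤ 2 * n) (hy : |y| ≤ 2) :
    |K / √(n + 1) * c - K / √(n + 1 + 1) * (c + y)| ≤ 4 * (K / √(n + 1)) := by
  have h1 : 0 < √(n + 1) := Real.sqrt_pos.2 (by linarith)
  have h2 : √(n + 1) ≤ √(n + 1 + 1) := Real.sqrt_le_sqrt (by linarith)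
  have h3 : 0 < √(n + 1 + 1) := h1.trans_le h2
  have hle : K / √(n + 1 + 1) ≤ K / √(n + 1) := by gcongr
  have h4 : (K / √(n + 1) - K / √(n + 1 + 1)) * n ≤ K / √(n + 1) := by
    have h5 : K / √(n + 1) * n - K / √(n + 1) ≤ K / √(n + 1 + 1) * n := by
      rw [← mul_sub_one, div_mul_eq_mul_div, div_mul_eq_mul_div, div_le_div_iff₀ h1 h3, mul_assoc,
        mul_assoc]
      refine mul_le_mul_of_nonneg_left ?_ hK
      have q1 := Real.sq_sqrt (by linarith : 0 ≤ n + 1)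
      have q2 := Real.sq_sqrt (by linarith : 0 ≤ n + 1 + 1)
      rcases le_or_gt n 1 with h | h
      · nlinarith [mul_nonneg hn h1.le, mul_nonneg (by linarith : 0 ≤ 1 - n) h3.le]
      · refine abs_le_of_sq_le_sq' ?_ (by positivity) |>.2
        rw [mul_pow, mul_pow, q1, q2]
        nlinarith
    linarith
  have e : K / √(n + 1) * c - K / √(n + 1 + 1) * (c + y)
      = (K / √(n + 1) - K / √(n + 1 + 1)) * c - K / √(n + 1 + 1) * y := by ring
  rw [e]
  have a1 : |(K / √(n + 1) - K / √(n + 1 + 1)) * c| ≤ 2 * (K / √(n + 1)) := by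
    rw [abs_mul, abs_of_nonneg (by linarith)]
    nlinarith
  have a2 : |K / √(n + 1 + 1) * y| ≤ 2 * (K / √(n + 1)) := by
    have : 0 ≤ K / √(n + 1 + 1) := by positivity
    rw [abs_mul, abs_of_nonneg this]
    nlinarith [abs_nonneg y]
  linarith [abs_sub ((K / √(n + 1) - K / √(n + 1 + 1)) * c) (K / √(n + 1 + 1) * y)]

end Rounds

/-! ### Loss mixtures and the partition of the rounds into windows. -/

theorem le_numWindows {S A : Type*} [Fintype S] {E : ℕ → S → Finset A} {t T : ℕ} (ht : t < T)
    (s : S) : (E (t + 1) s).card ≤ numWindows E T :=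
  (Finset.le_sup (f := fun s => (E (t + 1) s).card) (Finset.mem_univ s)).trans
    (Finset.le_sup (f := fun t => Finset.univ.sup fun s => (E (t + 1) s).card)
      (Finset.mem_range.2 ht))

theorem mem_Icc_of_mem_lossSimplex {S A : Type*} {L : ℕ} {ℓ : Fin L → S → A → ℝ}
    (hℓ : ∀ i s a, ℓ i s a ∈ Set.Icc (0 : ℝ) 1) {l : S → A → ℝ} (hl : l ∈ lossSimplex ℓ)
    (s : S) (a : A) : l s a ∈ Set.Icc (0 : ℝ) 1 := by
  obtain ⟨x, hx, rfl⟩ := hl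
  simpa using sum_mul_mem_Icc hx fun i => hℓ i s a

theorem convex_lossSimplex {S A : Type*} {L : ℕ} (ℓ : Fin L → S → A → ℝ) :
    Convex ℝ (lossSimplex ℓ) := by
  rintro _ ⟨x, hx, rfl⟩ _ ⟨y, hy, rfl⟩ a b ha hb hab
  refine ⟨a • x + b • y, convex_stdSimplex ℝ _ hx hy ha hb hab, ?_⟩
  simp [add_smul, Finset.sum_add_distrib, Finset.smul_sum, mul_smul]

section Windows

variable {S A : Type*} (E : ℕ → S → Finset A) (T : ℕ)

open Classical in
/-- The families of effective sets in force during the first `T` rounds. -/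
def windowFamilies : Finset (S → Finset A) :=
  (Finset.range T).image fun j => E (j + 1)

variable {E T} in
theorem mem_windowFamilies {F : S → Finset A} :
    F ∈ windowFamilies E T ↔ ∃ j < T, E (j + 1) = F := by
  simp [windowFamilies]

theorem sum_windowFamilies (g : ℕ → ℝ) :
    ∑ F ∈ windowFamilies E T, ∑ j ∈ roundsWith E T F, g j = ∑ j ∈ Finset.range T, g j := by
  classical
  have := Finset.sum_fiberwise_of_maps_to (s := Finset.range T) (t := windowFamilies E T)
    (g := fun j => E (j + 1)) (fun j hj => mem_windowFamilies.2 ⟨j, Finset.mem_range.1 hj, rfl⟩) g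
  rw [← this]
  refine Finset.sum_congr rfl fun F _ => Finset.sum_congr ?_ fun _ _ => rfl
  ext j
  simp [mem_roundsWith]

theorem card_windowFamilies_le : (windowFamilies E T).card ≤ T := by
  classical
  exact Finset.card_image_le.trans (Finset.card_range T).le

/-- Cauchy-Schwarz, since the window lengths add up to T. -/
theorem sum_sqrt_card_roundsWith_le :
    ∑ F ∈ windowFamilies E T, √((roundsWith E T F).card : ℝ)
      ≤ √((windowFamilies E T).card * T) := by
  refine Real.le_sqrt_of_sq_le (sq_sum_le_card_mul_sum_sq.trans_eq ?_)
  simp only [Real.sq_sqrt (Nat.cast_nonneg _)]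
  have := sum_windowFamilies E T fun _ => 1
  simp only [Finset.sum_const, nsmul_eq_mul, mul_one, Finset.card_range] at this
  rw [this]

variable {E T}

/-- Isolates the last round t of a window, which is treated separately in the regret bound. -/
theorem roundsWith_eq_empty_or (E : ℕ → S → Finset A) (T : ℕ) (F : S → Finset A) :
    roundsWith E T F = ∅ ∨
      ∃ t < T, E (t + 1) = F ∧ roundsWith E T F = roundsWith E (t + 1) F := by
  induction T with
  | zero => exact Or.inl roundsWith_zero
  | succ T ih =>
    by_cases h : E (T + 1) = F
    · exact Or.inr ⟨T, by omega, h, rfl⟩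
    · rw [roundsWith_succ_of_ne h]
      rcases ih with ih | ⟨t, ht, h1, h2⟩
      · exact Or.inl ih
      · exact Or.inr ⟨t, by omega, h1, h2⟩

end Windows

/-! ### Runs of the algorithm: windows, stationary regret and drift. -/

namespace IsOOERun

variable {S A : Type*} [Fintype S] [Fintype A] {M : OnlineMDP S A} {τ : ℝ}
  {l : ℕ → S → A → ℝ} {E : ℕ → S → Finset A} {f : ℕ → S → A} {π : ℕ → Policy S A}

theorem succ_eq_or_card (h : IsOOERun M τ l E f π) (t : ℕ) :
    (E (t + 1) = E t ∧ ∀ s, f t s ∈ E t s) ∨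
      ∀ s, E t s ⊆ E (t + 1) s ∧ (E (t + 1) s).card = (E t s).card + 1 := by
  classical
  by_cases hk : ∀ s, f t s ∈ E t s
  · exact Or.inl ⟨h.keep t hk, hk⟩
  · refine Or.inr fun s => ?_
    push Not at hk
    obtain ⟨h1, h2⟩ := h.expand t hk s
    by_cases hs : f t s ∈ E t s
    · obtain ⟨a, ha, he⟩ := h2 hs
      have he' : E (t + 1) s = insert a (E t s) := he
      rw [he']
      exact ⟨Finset.subset_insert _ _, Finset.card_insert_of_notMem ha⟩
    · have he' : E (t + 1) s = insert (f t s) (E t s) := h1 hs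
      rw [he']
      exact ⟨Finset.subset_insert _ _, Finset.card_insert_of_notMem hs⟩

theorem card_eq (h : IsOOERun M τ l E f π) (t : ℕ) (s s' : S) :
    (E t s).card = (E t s').card := by
  induction t with
  | zero => exact h.init_card s s'
  | succ t ih =>
    rcases h.succ_eq_or_card t with ⟨h1, -⟩ | h1
    · rw [h1, ih]
    · rw [(h1 s).2, (h1 s').2, ih]

theorem subset_of_le (h : IsOOERun M τ l E f π) {i j : ℕ} (hij : i ≤ j) (s : S) :
    E i s ⊆ E j s := by
  induction j, hij using Nat.le_induction with
  | base => exact subset_rfl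
  | succ j _ ih =>
    rcases h.succ_eq_or_card j with ⟨h1, -⟩ | h1
    · rw [h1]
      exact ih
    · exact ih.trans (h1 s).1

/-- The sets are nested, so their size determines them; grouping rounds by family of sets is
grouping by window. -/
theorem eq_of_card_eq (h : IsOOERun M τ l E f π) {i j : ℕ} {s : S}
    (hc : (E i s).card = (E j s).card) : E i = E j := by
  wlog hij : i ≤ j generalizing i j
  · exact (this hc.symm (by omega)).symm
  funext s'
  refine Finset.eq_of_subset_of_card_le (h.subset_of_le hij s') ?_
  rw [h.card_eq j s' s, h.card_eq i s' s, hc]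

/-- Holds even when the initial sets are empty: a set is kept only if it contains the best response,
and otherwise it receives an action. -/
theorem nonempty (h : IsOOERun M τ l E f π) (t : ℕ) (s : S) : (E (t + 1) s).Nonempty := by
  rcases h.succ_eq_or_card t with ⟨h1, h2⟩ | h1
  · rw [h1]
    exact ⟨_, h2 s⟩
  · rw [← Finset.card_pos, (h1 s).2]
    omega

/-- An earlier round has the same sets, so round t did not enlarge them, and an update without
enlargement means that the best response was already effective. -/
theorem bestResponse_mem (h : IsOOERun M τ l E f π) {j t : ℕ} (hjt : j < t)
    (he : E (j + 1) = E (t + 1)) : E t = E (t + 1) ∧ ∀ s, f t s ∈ E (t + 1) s := by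
  rcases h.succ_eq_or_card t with ⟨h1, h2⟩ | h1
  · rw [h1]
    exact ⟨rfl, h2⟩
  · obtain ⟨s⟩ := M.nonempty_states
    have h2 := Finset.card_le_card (h.subset_of_le (show j + 1 ≤ t by omega) s)
    rw [he, (h1 s).2] at h2
    omega

variable (hM : M.HasMixingTime τ) (hτ : 1 ≤ τ) (hl : ∀ j s a, l j s a ∈ Set.Icc (0 : ℝ) 1)

include hM hτ hl

theorem abs_feedback_le (j : ℕ) (s : S) (a : A) : |M.Q (π j) (l j) s a / (3 * τ)| ≤ 2 := by
  rw [abs_div, abs_of_pos (show 0 < 3 * τ by linarith), div_le_iff₀ (by linarith)]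
  linarith [hM.abs_Q_le hτ (π j) (hl j) s a]

theorem window_regret_detPolicy_le (h : IsOOERun M τ l E f π) (T : ℕ) {F : S → Finset A} {i : ℕ}
    (hF : ∀ s, (F s).card = i) {g : S → A} (hg : ∀ s, g s ∈ F s) :
    ∑ j ∈ roundsWith E T F, (M.avgLoss (l j) (π j) - M.avgLoss (l j) (detPolicy g))
      ≤ 150 * τ * √(Real.log i) * √((roundsWith E T F).card : ℝ) := by
  set x : S → ℕ → A → ℝ := fun s j a => M.Q (π j) (l j) s a / (3 * τ) with hx
  have hd := hM.statDist_mem hτ (detPolicy g)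
  calc _ = ∑ s, M.statDist (detPolicy g) s *
          (3 * τ * ∑ j ∈ roundsWith E T F, (∑ a, (π j s).1 a * x s j a - x s j (g s))) := by
        simp only [hM.avgLoss_sub_avgLoss hτ _ _ (hl _)]
        rw [Finset.sum_comm]
        refine Finset.sum_congr rfl fun s _ => ?_
        rw [← Finset.mul_sum]
        congr 1
        rw [Finset.mul_sum]
        refine Finset.sum_congr rfl fun j _ => ?_
        rw [sum_detPolicy_mul, mul_sub, Finset.mul_sum]
        have h3 : 3 * τ ≠ 0 := by linarith
        simp only [hx]
        congr 1
        · refine Finset.sum_congr rfl fun a _ => ?_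
          rw [mul_left_comm, mul_div_cancel₀ _ h3]
        · rw [mul_div_cancel₀ _ h3]
    _ ≤ ∑ s, M.statDist (detPolicy g) s *
          (3 * τ * (50 * √(Real.log i) * √((roundsWith E T F).card : ℝ))) := by
        refine Finset.sum_le_sum fun s _ => mul_le_mul_of_nonneg_left
          (mul_le_mul_of_nonneg_left ?_ (by linarith)) (hd.1 s)
        have := expWeights_regret_le (E := E) (F := F) (F₀ := F s) (x := x s)
          (p := fun j => (π j s).1) (abs_feedback_le hM hτ hl · s)
          (fun j hj a => by
            have := h.play j s a
            rwa [hj] at this) (hg s) T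
        rwa [hF s] at this
    _ = _ := by
        rw [← Finset.sum_mul, hd.2]
        ring

theorem window_regret_le (h : IsOOERun M τ l E f π) (ρ : Policy S A) (T : ℕ)
    {F : S → Finset A} {i : ℕ} (hF : ∀ s, (F s).card = i) :
    ∑ j ∈ roundsWith E T F, (M.avgLoss (l j) (π j) - M.avgLoss (l j) ρ)
      ≤ 1 + 150 * τ * √(Real.log i) * √((roundsWith E T F).card : ℝ) := by
  rcases roundsWith_eq_empty_or E T F with h0 | ⟨t, -, rfl, h1⟩
  · simp [h0]
  rw [h1, sum_roundsWith_succ_of_eq rfl]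
  have hlast : M.avgLoss (l t) (π t) - M.avgLoss (l t) ρ ≤ 1 := by
    linarith [(hM.avgLoss_mem_Icc hτ (π t) (hl t)).2, (hM.avgLoss_mem_Icc hτ ρ (hl t)).1]
  have hmono : 150 * τ * √(Real.log i) * √((roundsWith E t (E (t + 1))).card : ℝ)
      ≤ 150 * τ * √(Real.log i) * √((roundsWith E (t + 1) (E (t + 1))).card : ℝ) := by
    rw [card_roundsWith_succ_of_eq rfl]
    push_cast
    gcongr
    linarith
  -- If t is the only round of its window, the bound 1 is enough. Otherwise `f t` is effective and
  -- optimal for the window's rounds before t, so regret against it dominates regret against ρ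
  -- there.
  rcases (roundsWith E t (E (t + 1))).eq_empty_or_nonempty with h2 | ⟨j, hj⟩
  · have : 0 ≤ 150 * τ * √(Real.log i) * √((roundsWith E (t + 1) (E (t + 1))).card : ℝ) := by
      positivity
    rw [h2, Finset.sum_empty]
    linarith
  · obtain ⟨hjt, hje⟩ := mem_roundsWith.1 hj
    obtain ⟨h3, h4⟩ := h.bestResponse_mem hjt hje
    have h5 := window_regret_detPolicy_le hM hτ hl h t hF h4
    have h6 := hM.sum_avgLoss_le_of_isBestResponse hτ hl (h.best_response t) ρ
    rw [h3] at h6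
    rw [Finset.sum_sub_distrib] at h5 ⊢
    linarith

omit hM hτ hl

theorem exists_card_eq (h : IsOOERun M τ l E f π) {T : ℕ} {F : S → Finset A}
    (hF : F ∈ windowFamilies E T) :
    ∃ i, 1 ≤ i ∧ i ≤ numWindows E T ∧ ∀ s, (F s).card = i := by
  classical
  obtain ⟨s⟩ := M.nonempty_states
  obtain ⟨t, ht, rfl⟩ := mem_windowFamilies.1 hF
  exact ⟨(E (t + 1) s).card, Finset.card_pos.2 (h.nonempty t s),
    le_numWindows ht s, fun s' => h.card_eq _ s' s⟩

theorem card_windowFamilies_le_numWindows (h : IsOOERun M τ l E f π) (T : ℕ) :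
    (windowFamilies E T).card ≤ numWindows E T := by
  classical
  obtain ⟨s⟩ := M.nonempty_states
  have := Finset.card_le_card_of_injOn (s := windowFamilies E T)
    (t := Finset.Icc 1 (numWindows E T)) (fun F => (F s).card) (fun F hF => by
      obtain ⟨i, h1, h2, h3⟩ := h.exists_card_eq hF
      simp only [h3, Finset.coe_Icc, Set.mem_Icc]
      exact ⟨h1, h2⟩) (by
      intro F hF G hG hFG
      obtain ⟨t, -, rfl⟩ := mem_windowFamilies.1 hF
      obtain ⟨t', -, rfl⟩ := mem_windowFamilies.1 hG
      exact h.eq_of_card_eq hFG)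
  simpa using this

/-- c² ≤ Tk ≤ 4 Tk log k, because log 2 ≥ 1/4; this absorbs costs that are constant per window. -/
theorem le_sqrt_windows {c T k : ℕ} (hk : 2 ≤ k) (hcT : c ≤ T) (hck : c ≤ k) :
    (c : ℝ) ≤ 2 * √(T * k * Real.log k) := by
  have h1 : (c : ℝ) ^ 2 ≤ T * k := by
    rw [sq]
    gcongr
  have h2 : (1 / 4 : ℝ) ≤ Real.log k := by
    have := Real.log_le_log (by norm_num) (show (2 : ℝ) ≤ k by exact_mod_cast hk)
    linarith [Real.log_two_gt_d9]
  refine abs_le_of_sq_le_sq' ?_ (by positivity) |>.2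
  rw [mul_pow, Real.sq_sqrt (by positivity)]
  have : (0 : ℝ) ≤ T * k := by positivity
  nlinarith

include hM hτ hl

theorem regret_le (h : IsOOERun M τ l E f π) (ρ : Policy S A) {T k : ℕ}
    (hk : k = numWindows E T) :
    ∑ j ∈ Finset.range T, (M.avgLoss (l j) (π j) - M.avgLoss (l j) ρ)
      ≤ 1 + 2 * √(T * k * Real.log k) + 150 * τ * √(T * k * Real.log k) := by
  set m := (windowFamilies E T).card with hm
  have hmk : m ≤ k := hk ▸ h.card_windowFamilies_le_numWindows T
  have hmT : m ≤ T := card_windowFamilies_le E T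
  have h1 : (m : ℝ) ≤ 1 + 2 * √(T * k * Real.log k) := by
    -- For k ≤ 1 the square root vanishes, and the at most one window is paid for by the constant 1.
    rcases le_or_gt 2 k with h2 | h2
    · linarith [le_sqrt_windows h2 hmT hmk]
    · have : (m : ℝ) ≤ 1 := by exact_mod_cast (by omega : m ≤ 1)
      have : 0 ≤ √(T * k * Real.log k) := Real.sqrt_nonneg _
      linarith
  rw [← sum_windowFamilies E T]
  calc _ ≤ ∑ F ∈ windowFamilies E T,
          (1 + 150 * τ * √(Real.log k) * √((roundsWith E T F).card : ℝ)) := by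
        refine Finset.sum_le_sum fun F hF => ?_
        obtain ⟨i, hi1, hik, hi⟩ := h.exists_card_eq hF
        refine (window_regret_le hM hτ hl h ρ T hi).trans ?_
        have : (0 : ℝ) < i := by exact_mod_cast hi1
        rw [hk]
        gcongr
    _ ≤ m + 150 * τ * √(Real.log k) * √(m * T) := by
        rw [Finset.sum_add_distrib, ← Finset.mul_sum, Finset.sum_const, nsmul_eq_mul, mul_one]
        gcongr
        exact sum_sqrt_card_roundsWith_le E T
    _ ≤ m + 150 * τ * √(T * k * Real.log k) := by
        rw [mul_assoc, ← Real.sqrt_mul (Real.log_natCast_nonneg k)]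
        gcongr _ + 150 * τ * √?_
        rw [mul_comm, mul_comm (m : ℝ)]
        have := Real.log_natCast_nonneg k
        gcongr
    _ ≤ _ := by linarith

theorem statDist_drift_le (h : IsOOERun M τ l E f π) {t : ℕ} (he : E (t + 2) = E (t + 1)) {k : ℕ}
    (hk : ∀ s, (E (t + 1) s).card ≤ k) :
    ∑ s, |M.statDist (π t) s - M.statDist (π (t + 1)) s|
      ≤ 92 * τ * √(Real.log k) * (1 / √((roundsWith E t (E (t + 1))).card + 1 : ℝ)) := by
  set n := (roundsWith E t (E (t + 1))).card with hn
  -- Exponents move by at most D = 4K/√(n+1), so the weights move by 4D, and 16√8 < 46.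
  have hδ : ∀ s, ∑ a, |(π t s).1 a - (π (t + 1) s).1 a|
      ≤ 46 * √(Real.log k) * (1 / √(n + 1 : ℝ)) := by
    intro s
    set K := √(8 * Real.log (E (t + 1) s).card) with hK
    have hlog : 0 ≤ 8 * Real.log (E (t + 1) s).card := by
      have := Real.log_natCast_nonneg (E (t + 1) s).card
      linarith
    have hp1 : (π t s).1 = expWeights (E (t + 1) s) (K / √(n + 1 : ℝ))
        (fun b => ∑ j ∈ roundsWith E t (E (t + 1)), M.Q (π j) (l j) s b / (3 * τ)) := by
      funext a
      rw [h.play t s a, Real.sqrt_div hlog]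
    have hp2 : (π (t + 1) s).1 = expWeights (E (t + 1) s) (K / √(n + 1 + 1 : ℝ))
        (fun b => ∑ j ∈ roundsWith E t (E (t + 1)), M.Q (π j) (l j) s b / (3 * τ)
          + M.Q (π t) (l t) s b / (3 * τ)) := by
      funext a
      rw [h.play (t + 1) s a, show t + 1 + 1 = t + 2 from rfl, he, Real.sqrt_div hlog,
        card_roundsWith_succ_of_eq rfl]
      simp only [fun b => sum_roundsWith_succ_of_eq (E := E) (t := t) rfl
        (fun j => M.Q (π j) (l j) s b / (3 * τ))]
      push_cast
      rfl
    rw [hp1, hp2]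
    refine (sum_abs_expWeights_sub_le (h.nonempty t s) (D := 4 * (K / √(n + 1 : ℝ)))
      fun a _ => rate_drift_le (Nat.cast_nonneg n) (Real.sqrt_nonneg _) ?_
        (abs_feedback_le hM hτ hl t s a)).trans ?_
    · refine (Finset.abs_sum_le_sum_abs _ _).trans
        ((Finset.sum_le_card_nsmul _ _ 2 fun j _ => abs_feedback_le hM hτ hl j s a).trans_eq ?_)
      rw [nsmul_eq_mul, mul_comm]
    · have hKk : K ≤ √8 * √(Real.log k) := by
        rw [hK, ← Real.sqrt_mul (by norm_num)]
        have : (0 : ℝ) < (E (t + 1) s).card := by exact_mod_cast (h.nonempty t s).card_pos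
        have := hk s
        gcongr
      have h8 : √8 ≤ (2.83 : ℝ) := by
        rw [Real.sqrt_le_left (by norm_num)]
        norm_num
      have h9 : 16 * K ≤ 46 * √(Real.log k) := by
        nlinarith [Real.sqrt_nonneg (Real.log k)]
      calc 4 * (4 * (K / √(n + 1 : ℝ))) = 16 * K * (1 / √(n + 1 : ℝ)) := by ring
        _ ≤ _ := by gcongr
  refine (hM.sum_abs_statDist_sub_le hτ _ _ hδ).trans_eq ?_
  ring

omit hM hτ hl

-- Each change of window raises the size by exactly one, so sizes telescope.
open Classical in
theorem sum_changes_add_card (h : IsOOERun M τ l E f π) (T : ℕ) (s : S) :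
    ∑ t ∈ Finset.range T, (if E (t + 2) = E (t + 1) then 0 else 1) + (E 1 s).card
      = (E (T + 1) s).card := by
  induction T with
  | zero => simp
  | succ T ih =>
    rw [Finset.sum_range_succ]
    split_ifs with he
    · rw [he]
      omega
    · rcases h.succ_eq_or_card (T + 1) with ⟨h1, -⟩ | h1
      · exact absurd h1 he
      · have := (h1 s).2
        omega

open Classical in
theorem sum_changes_le (h : IsOOERun M τ l E f π) {T k : ℕ} (hk : k = numWindows E (T + 1)) :
    ((∑ t ∈ Finset.range T, (if E (t + 2) = E (t + 1) then 0 else 1) : ℕ) : ℝ)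
      ≤ 2 * √((T + 1 : ℕ) * k * Real.log k) := by
  obtain ⟨s⟩ := M.nonempty_states
  have h1 := h.sum_changes_add_card T s
  -- The first set in force is nonempty, so there are at most k - 1 changes: none for k = 1, where
  -- the bound is 0.
  have h2 := (h.nonempty 0 s).card_pos
  have h3 : (E (T + 1) s).card ≤ k := hk ▸ le_numWindows (Nat.lt_succ_self T) s
  have h4 : ∑ t ∈ Finset.range T, (if E (t + 2) = E (t + 1) then 0 else 1) ≤ T := by
    refine (Finset.sum_le_card_nsmul _ _ 1 fun t _ => ?_).trans (by simp)
    split_ifs <;> simp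
  simp only [zero_add] at h2
  rcases le_or_gt 2 k with hk2 | hk2
  · exact le_sqrt_windows hk2 (by omega) (by omega)
  · have : ∑ t ∈ Finset.range T, (if E (t + 2) = E (t + 1) then 0 else 1) = 0 := by omega
    rw [this]
    simp

include hM hτ hl

theorem sum_statDist_drift_le (h : IsOOERun M τ l E f π) {T k : ℕ}
    (hk : k = numWindows E (T + 1)) :
    ∑ t ∈ Finset.range T, ∑ s, |M.statDist (π t) s - M.statDist (π (t + 1)) s|
      ≤ 188 * τ * √((T + 1 : ℕ) * k * Real.log k) := by
  classical
  set X := √((T + 1 : ℕ) * k * Real.log k) with hX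
  have hX0 : 0 ≤ X := Real.sqrt_nonneg _
  set z : ℕ → ℝ := fun t => 1 / √((roundsWith E t (E (t + 1))).card + 1 : ℝ) with hz
  have hz0 : ∀ t, 0 ≤ z t := fun t => by positivity
  have hterm : ∀ t ∈ Finset.range T, ∑ s, |M.statDist (π t) s - M.statDist (π (t + 1)) s|
      ≤ 2 * ((if E (t + 2) = E (t + 1) then 0 else 1 : ℕ) : ℝ)
        + 92 * τ * √(Real.log k) * z t := by
    intro t ht
    have hp : 0 ≤ 92 * τ * √(Real.log k) * z t := mul_nonneg (by positivity) (hz0 t)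
    split_ifs with he
    · have := statDist_drift_le hM hτ hl h he (k := k)
        fun s => hk ▸ le_numWindows (by have := Finset.mem_range.1 ht; omega) s
      simpa only [Nat.cast_zero, mul_zero, zero_add, hz] using this
    · have := sum_abs_sub_le_two (hM.statDist_mem hτ (π t)) (hM.statDist_mem hτ (π (t + 1)))
      push_cast
      linarith
  have hzsum : ∑ t ∈ Finset.range T, z t
      ≤ 2 * √((windowFamilies E (T + 1)).card * (T + 1 : ℕ)) := by
    calc ∑ t ∈ Finset.range T, z t ≤ ∑ t ∈ Finset.range (T + 1), z t := by
          rw [Finset.sum_range_succ]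
          linarith [hz0 T]
      _ = ∑ F ∈ windowFamilies E (T + 1), ∑ j ∈ roundsWith E (T + 1) F,
            1 / √((roundsWith E j F).card + 1 : ℝ) := by
          rw [← sum_windowFamilies E (T + 1)]
          refine Finset.sum_congr rfl fun F _ => Finset.sum_congr rfl fun j hj => ?_
          simp only [hz, (mem_roundsWith.1 hj).2]
      _ ≤ ∑ F ∈ windowFamilies E (T + 1), 2 * √((roundsWith E (T + 1) F).card : ℝ) :=
          Finset.sum_le_sum fun F _ => sum_inv_sqrt_le E F (T + 1)
      _ ≤ _ := by
          rw [← Finset.mul_sum]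
          gcongr
          exact sum_sqrt_card_roundsWith_le E (T + 1)
  have hmX : √(Real.log k) * √((windowFamilies E (T + 1)).card * (T + 1 : ℕ)) ≤ X := by
    rw [← Real.sqrt_mul (Real.log_natCast_nonneg k), hX, mul_comm,
      mul_comm ((windowFamilies E (T + 1)).card : ℝ)]
    have := Real.log_natCast_nonneg k
    have : (windowFamilies E (T + 1)).card ≤ k :=
      hk ▸ h.card_windowFamilies_le_numWindows (T + 1)
    gcongr
  calc _ ≤ ∑ t ∈ Finset.range T, (2 * ((if E (t + 2) = E (t + 1) then 0 else 1 : ℕ) : ℝ)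
        + 92 * τ * √(Real.log k) * z t) := Finset.sum_le_sum hterm
    -- Window changes cost at most 2 each and number at most 2X; the drift inside windows is summed
    -- by Cauchy-Schwarz.
    _ ≤ 2 * (2 * X) + 92 * τ * √(Real.log k) *
          (2 * √((windowFamilies E (T + 1)).card * (T + 1 : ℕ))) := by
        rw [Finset.sum_add_distrib, ← Finset.mul_sum, ← Finset.mul_sum, ← Nat.cast_sum]
        gcongr
        exact h.sum_changes_le hk
    _ = 4 * X + 184 * τ *
          (√(Real.log k) * √((windowFamilies E (T + 1)).card * (T + 1 : ℕ))) := by ring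
    _ ≤ 4 * X + 184 * τ * X := by gcongr
    _ ≤ _ := by nlinarith

end IsOOERun

/-! ### The adversary's regret and the final assembly. -/

theorem Adversary.losses_mem_Icc {S A : Type*} [Fintype S] [Fintype A] {L : ℕ}
    {ℓ : Fin L → S → A → ℝ} (hℓ : ∀ i s a, ℓ i s a ∈ Set.Icc (0 : ℝ) 1) (adv : Adversary ℓ)
    (π : ℕ → Policy S A) (t : ℕ) (s : S) (a : A) : adv.losses π t s a ∈ Set.Icc (0 : ℝ) 1 :=
  mem_Icc_of_mem_lossSimplex hℓ (adv.play_mem _ _) s a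

/-- A no-regret adversary hurts a fixed policy at least as much as any sequence of its losses. -/
theorem Adversary.NoRegret.sum_avgLoss_sub_le {S A : Type*} [Fintype S] [Fintype A] {L : ℕ}
    {ℓ : Fin L → S → A → ℝ} {adv : Adversary ℓ} {M : OnlineMDP S A} {T : ℕ}
    (h : adv.NoRegret M (T + 1)) {l : ℕ → S → A → ℝ} (hl : ∀ t, l t ∈ lossSimplex ℓ)
    (ρ : Policy S A) :
    ∑ t ∈ Finset.range (T + 1), M.avgLoss (l t) ρ
      - ∑ t ∈ Finset.range (T + 1), M.avgLoss (adv.losses (fun _ => ρ) t) ρ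
      ≤ √((T + 1 : ℕ) * Real.log L / 2) := by
  have hT : ((T + 1 : ℕ) : ℝ) ≠ 0 := by positivity
  -- The time average is an admissible fixed loss; T + 1 times its value at ρ is the first sum.
  have hmem : ((T + 1 : ℕ) : ℝ)⁻¹ • ∑ t ∈ Finset.range (T + 1), l t ∈ lossSimplex ℓ := by
    rw [Finset.smul_sum]
    refine (convex_lossSimplex ℓ).sum_mem (fun _ _ => by positivity) ?_ fun t _ => hl t
    rw [Finset.sum_const, Finset.card_range, nsmul_eq_mul, mul_inv_cancel₀ hT]
  have := h (fun _ => ρ) _ hmem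
  rwa [OnlineMDP.avgLoss_smul, OnlineMDP.avgLoss_sum, Finset.sum_const, Finset.card_range,
    nsmul_eq_mul, mul_inv_cancel_left₀ hT] at this

theorem policyRegret_le {S A : Type*} [Fintype S] [Fintype A] {M : OnlineMDP S A} {τ : ℝ}
    (hτ : 1 ≤ τ) (hM : M.HasMixingTime τ) {L : ℕ} {ℓ : Fin L → S → A → ℝ}
    (hℓ : ∀ i s a, ℓ i s a ∈ Set.Icc (0 : ℝ) 1) {T : ℕ} {adv : Adversary ℓ}
    (hadv : adv.NoRegret M (T + 1)) {E : ℕ → S → Finset A} {f : ℕ → S → A} {π : ℕ → Policy S A}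
    (h : IsOOERun M τ (adv.losses π) E f π) {k : ℕ} (hk : k = numWindows E (T + 1))
    (ρ : Policy S A) :
    adv.policyRegret M π ρ (T + 1)
      ≤ 528 * τ ^ 2 * √((T + 1 : ℕ) * k * Real.log k) + √((T + 1 : ℕ) * Real.log L) + 9 * τ := by
  have h1 := abs_le.1 (hM.abs_expectedLoss_sub_le hτ π (adv.losses_mem_Icc hℓ π) T)
  have h2 := abs_le.1 (hM.abs_expectedLoss_sub_le hτ (fun _ => ρ)
    (adv.losses_mem_Icc hℓ fun _ => ρ) T)
  have h3 := h.sum_statDist_drift_le hM hτ (adv.losses_mem_Icc hℓ π) hk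
  have h4 := h.regret_le hM hτ (adv.losses_mem_Icc hℓ π) ρ hk
  have h5 := hadv.sum_avgLoss_sub_le (l := adv.losses π) (fun t => adv.play_mem _ _) ρ
  have h6 : √((T + 1 : ℕ) * Real.log L / 2) ≤ √((T + 1 : ℕ) * Real.log L) := by
    refine Real.sqrt_le_sqrt (half_le_self ?_)
    have := Real.log_natCast_nonneg L
    positivity
  rw [Finset.sum_sub_distrib] at h4
  simp only [sub_self, abs_zero, Finset.sum_const_zero] at h2
  set X := √((T + 1 : ℕ) * k * Real.log k)
  have hX : 0 ≤ X := Real.sqrt_nonneg _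
  -- Everything is put in units of τ²X: 528 = 2·188 + 150 + 2. The remaining 9τ is 4τ from each
  -- initial law plus the 1 of the regret bound.
  have h7 : τ * X ≤ τ ^ 2 * X := by nlinarith [mul_nonneg (by linarith : (0 : ℝ) ≤ τ) hX]
  have h8 : X ≤ τ * X := by nlinarith
  have h9 := mul_le_mul_of_nonneg_left h3 (by linarith : 0 ≤ 2 * τ)
  rw [Adversary.policyRegret]
  nlinarith

theorem mainTheorem5 :
    ∃ C : ℝ, 0 < C ∧
      ∀ (S : Type u) (A : Type v) [Fintype S] [Fintype A] (M : OnlineMDP S A)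
        (τ : ℝ) (_ : 1 ≤ τ) (_ : M.HasMixingTime τ)
        (L : ℕ) (ℓ : Fin L → S → A → ℝ) (_ : ∀ i s a, ℓ i s a ∈ Set.Icc (0 : ℝ) 1)
        (T : ℕ) (adv : Adversary ℓ) (_ : adv.NoRegret M T)
        (E : ℕ → S → Finset A) (f : ℕ → S → A) (π : ℕ → Policy S A)
        (_ : IsOOERun M τ (adv.losses π) E f π)
        (k : ℕ) (_ : k = numWindows E T) (ρ : Policy S A),
        adv.policyRegret M π ρ T
            ≤ C * (τ ^ 2 * √(T * k * Real.log k) + √(T * Real.log L) + τ) ∧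
        ((2 ≤ k ∨ (2 ≤ L ∧ τ ^ 2 ≤ T)) →
          adv.policyRegret M π ρ T
            ≤ C * (τ ^ 2 * √(T * k * Real.log k) + √(T * Real.log L))) := by
  refine ⟨1000, by norm_num, ?_⟩
  intro S A _ _ M τ hτ hM L ℓ hℓ T adv hadv E f π h k hk ρ
  have hX : 0 ≤ √((T : ℝ) * k * Real.log k) := Real.sqrt_nonneg _
  have hY : 0 ≤ √((T : ℝ) * Real.log L) := Real.sqrt_nonneg _
  rcases T with _ | T
  · have h0 : adv.policyRegret M π ρ 0 = 0 := by
      simp [Adversary.policyRegret, OnlineMDP.expectedLoss]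
    rw [h0]
    exact ⟨by positivity, fun _ => by positivity⟩
  have key := policyRegret_le hτ hM hℓ hadv h hk ρ
  set X := √(((T + 1 : ℕ) : ℝ) * k * Real.log k) with hXdef
  set Y := √(((T + 1 : ℕ) : ℝ) * Real.log L) with hYdef
  have hX2 : 0 ≤ τ ^ 2 * X := by positivity
  refine ⟨by linarith, fun hcase => ?_⟩
  have hlog : ∀ n : ℕ, 2 ≤ n → (1 / 2 : ℝ) ≤ Real.log n := fun n hn => by
    have := Real.log_le_log (by norm_num) (show (2 : ℝ) ≤ n by exact_mod_cast hn)
    linarith [Real.log_two_gt_d9]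
  rcases hcase with hk2 | ⟨hL, hT⟩
  -- Here T ≥ 1, k ≥ 2 and log k ≥ 1/2, so X ≥ 1 and τ is absorbed by τ²X.
  · have h1 : 1 ≤ X := by
      refine Real.le_sqrt_of_sq_le ?_
      have h2 := hlog k hk2
      have h3 : (2 : ℝ) ≤ k := by exact_mod_cast hk2
      have h4 : (1 : ℝ) ≤ (T + 1 : ℕ) := by exact_mod_cast Nat.succ_pos T
      calc (1 : ℝ) ^ 2 = 1 * 2 * (1 / 2) := by norm_num
        _ ≤ _ := by gcongr
    have h5 : τ ≤ τ ^ 2 * X := by nlinarith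
    linarith
  -- Here T log L ≥ τ²/2, so τ is absorbed by √(T log L).
  · have h1 : τ / 2 ≤ Y := by
      refine Real.le_sqrt_of_sq_le ?_
      have h2 := hlog L hL
      calc (τ / 2) ^ 2 ≤ τ ^ 2 * (1 / 2) := by nlinarith [sq_nonneg τ]
        _ ≤ _ := by gcongr
    linarith

end
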